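/- Setting. Let $K,R\ge 1$ be integers. A mechanism sends each dataset $D$ to a probability distribution; datasets form an arbitrary set with a symmetric neighbouring relation. A mechanism $\mathcal M$ is $(\varepsilon,\delta)$-DP if $\Pr[\mathcal M(D)\in S]\le e^{\varepsilon}\Pr[\mathcal M(D')\in S]+\delta$ for all neighbouring $D,D'$ and all measurable $S$, and $\varepsilon$-DP if it is $(\varepsilon,0)$-DP. Each of the $K$ candidates $\mathcal M_1,\dots,\mathcal M_K$ is a mechanism whose output is a pair $(x,q)$ with $x$ in a measurable space $\Omega$ and a score (quality) $q\in[0,1]$. Put $$\mathrm{Median}(\mathcal M_i(D))=\sup\Big\{\tau:\Pr_{(x,q)\sim\mathcal M_i(D)}[q\ge\tau]\ge\tfrac12\Big\},\qquad \tau^*(D)=\max_{1\le i\le K}\mathrm{Median}(\mathcal M_i(D)).$$ A selection algorithm is an adaptive randomized procedure that has access to $D$ only through oracle calls: a call to $i$ returns a fresh independent sample from $\mathcal M_i(D)$. When it halts it outputs either $\bot$ or a pair $(i,(x,q))$, where $(x,q)$ is one of the samples that it received from a call to $i$. Let $\widetilde T$ be its number of oracle calls. Theorem. There is an absolute constant $C>0$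 such that the following holds for all integers $K,R\ge1$, all $\varepsilon_1>0$, $\varepsilon_0\in(0,1]$, $\beta>0$, $\delta\in(0,1)$ and every measurable space $\Omega$. There is a selection algorithm $\mathcal M$ such that for all $\varepsilon_1$-DP candidates $\mathcal M_1,\dots,\mathcal M_K$ as above (on any set of datasets): (a) $\mathcal M$ is $(2\varepsilon_1+\varepsilon_0,\delta)$-DP. Moreover, on every dataset $D$: (b) the probability that $\mathcal M$ outputs a pair $(i,(x,q))$ with $q<\tau^*(D)-\frac1R$ is at most $\beta+\frac{\delta}{R}$; (c) the number of oracle calls satisfies $$\mathbb E\,\widetilde T\le C\,K\Big(\frac{R+1}{\beta^2}\Big)^{6+\frac{12\varepsilon_1}{\varepsilon_0}}\Big(\frac{\ln(R/\delta)}{\varepsilon_0^2}+\frac1\beta\Big),$$ and, in every execution (deterministically), $$\widetilde T\le C\,K\Big(\frac{R+1}{\beta^2}\Big)^{6+\frac{12\varepsilon_1}{\varepsilon_0}}\Big(\frac{\ln(R/\delta)}{\varepsilon_0^2}+\frac{\ln(1/\varepsilon_0)}{\beta}\Big);$$ (d) $\Pr[\mathcal M\text{ outputs }\bot]\le\beta+\delta$.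 -/

import Mathlib

open MeasureTheory
open scoped ENNReal

universe u v

noncomputable section

namespace PrivateSelection

/-! ### Differential privacy -/

/-- `(ε, δ)`-differential privacy, with respect to the neighbouring relation `adj`, of a randomized
mechanism `P` that sends a dataset to the law of its output. -/
def IsDP {𝒟 : Type u} {Y : Type v} [MeasurableSpace Y] (adj : 𝒟 → 𝒟 → Prop) (ε δ : ℝ)
    (P : 𝒟 → ProbabilityMeasure Y) : Prop :=
  ∀ D D' : 𝒟, adj D D' → ∀ S : Set Y, MeasurableSet S →
    (P D : Measure Y).real S ≤ Real.exp ε * (P D' : Measure Y).real S + δ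

/-! ### Scored samples -/

/-- What one run of a candidate returns: an output `x : Ω` with its score in `[0, 1]`. -/
abbrev Scored (Ω : Type v) : Type v := Ω × unitInterval

/-- The median score of a law of scored samples: `sup {τ : Pr[q ≥ τ] ≥ 1/2}`. -/
def medianScore {Ω : Type v} [MeasurableSpace Ω] (μ : ProbabilityMeasure (Scored Ω)) : ℝ :=
  sSup {τ : ℝ | 1 / 2 ≤ (μ : Measure (Scored Ω)).real {z | τ ≤ (z.2 : ℝ)}}

/-- The largest median score among the `K` candidates. -/
def bestMedian {Ω : Type v} [MeasurableSpace Ω] {K : ℕ}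
    (M : Fin K → ProbabilityMeasure (Scored Ω)) : ℝ :=
  ⨆ i, medianScore (M i)

/-! ### Randomized algorithms with sampling access to `K` candidates -/

/-- The transcript of `n` oracle calls: which candidate was called, and the sample it returned. -/
abbrev Transcript (K : ℕ) (X : Type v) (n : ℕ) : Type v := Fin n → Fin K × X

/-- The output of a selection algorithm: `⊥` is `Sum.inl ()`, and `Sum.inr (i, x)` is the candidate
`i` together with the sample `x`. -/
abbrev Outcome (K : ℕ) (X : Type v) : Type v := Unit ⊕ (Fin K × X)

/-- An adaptive randomized algorithm whose only access to the candidates is by oracle calls.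
Its internal randomness is a seed, which it may consult gradually. After `n` calls it decides, from
the seed and the transcript so far, whether to halt (`halt`); if it does not, `query` is the
candidate that it calls next; if it does, `release` says which of the `n` samples received so far
is output (`none` stands for `⊥`). -/
structure OracleAlgorithm (K : ℕ) (X : Type v) [MeasurableSpace X] where
  Seed : Type
  [seedSpace : MeasurableSpace Seed]
  seedLaw : ProbabilityMeasure Seed
  halt : (n : ℕ) → Set (Seed × Transcript K X n)
  query : (n : ℕ) → Seed × Transcript K X n → Fin K
  release : (n : ℕ) → Seed × Transcript K X n → Option (Fin n)
  measurableSet_halt : ∀ n, MeasurableSet (halt n)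
  measurable_query : ∀ n, Measurable (query n)
  measurableSet_release : ∀ n a, MeasurableSet {z | release n z = a}

namespace OracleAlgorithm

attribute [instance] OracleAlgorithm.seedSpace

variable {K : ℕ} {X : Type v} [MeasurableSpace X] (A : OracleAlgorithm K X)

/-- The sample space of an execution: a seed and a tape. The `n`-th call (counting from `0`), if it
goes to candidate `i`, is answered by the tape entry `(n, i)`; all other entries stay unread. -/
abbrev Randomness : Type v := A.Seed × (ℕ → Fin K → X)

/-- The transcript of the first `n` calls (of no relevance for `n` beyond the halting time). -/
def transcript (ω : A.Randomness) : (n : ℕ) → Transcript K X n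
  | 0 => Fin.elim0
  | n + 1 =>
    Fin.snoc (α := fun _ => Fin K × X) (transcript ω n)
      (A.query n (ω.1, transcript ω n), ω.2 n (A.query n (ω.1, transcript ω n)))

/-- The algorithm is told to halt once it has made `n` calls. -/
def HaltsAt (ω : A.Randomness) (n : ℕ) : Prop := (ω.1, A.transcript ω n) ∈ A.halt n

/-- The number of oracle calls of an execution (`⊤` if it never halts). -/
def calls (ω : A.Randomness) : ℕ∞ := ⨅ (n : ℕ) (_ : A.HaltsAt ω n), (n : ℕ∞)

/-- What is output on halting after `n` calls. -/
def outcomeAt (n : ℕ) (z : A.Seed × Transcript K X n) : Outcome K X :=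
  match A.release n z with
  | none => Sum.inl ()
  | some j => Sum.inr (z.2 j)

open Classical in
/-- The output of an execution (`⊥` if it never halts). -/
def outcome (ω : A.Randomness) : Outcome K X :=
  if h : ∃ n, A.HaltsAt ω n then A.outcomeAt (Nat.find h) (ω.1, A.transcript ω (Nat.find h))
  else Sum.inl ()

theorem measurable_transcript (n : ℕ) : Measurable fun ω : A.Randomness => A.transcript ω n := by
  induction n with
  | zero => exact measurable_pi_lambda _ fun i => i.elim0
  | succ n ih =>
    have hz : Measurable fun ω : A.Randomness => (ω.1, A.transcript ω n) :=
      measurable_fst.prodMk ih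
    have hq := (A.measurable_query n).comp hz
    refine measurable_pi_lambda _ fun j => ?_
    refine Fin.lastCases ?_ (fun j => ?_) j
    · simp only [transcript, Fin.snoc_last]
      refine hq.prodMk ?_
      have h2 : Measurable fun p : (Fin K → X) × Fin K => p.1 p.2 :=
        measurable_from_prod_countable_left fun i => measurable_pi_apply i
      exact h2.comp (((measurable_pi_apply n).comp measurable_snd).prodMk hq)
    · simp only [transcript, Fin.snoc_castSucc]
      exact (measurable_pi_apply j).comp ih

theorem measurable_outcomeAt (n : ℕ) : Measurable (A.outcomeAt n) := by
  intro S hS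
  have : A.outcomeAt n ⁻¹' S = ⋃ a : Option (Fin n), {z | A.release n z = a} ∩
      {z : A.Seed × Transcript K X n | (match a with
        | none => Sum.inl ()
        | some j => Sum.inr (z.2 j) : Outcome K X) ∈ S} := by
    ext z
    simp [outcomeAt]
  rw [this]
  refine MeasurableSet.iUnion fun a => (A.measurableSet_release n a).inter ?_
  cases a with
  | none => exact (measurable_const (a := (Sum.inl () : Outcome K X))) hS
  | some j =>
    exact (measurable_inr.comp ((measurable_pi_apply j).comp measurable_snd)) hS

theorem measurable_outcome : Measurable A.outcome := by
  classical
  have hz : ∀ n, Measurable fun ω : A.Randomness => (ω.1, A.transcript ω n) := fun n =>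
    measurable_fst.prodMk (A.measurable_transcript n)
  have hH : ∀ n, MeasurableSet {ω | A.HaltsAt ω n} := fun n => hz n (A.measurableSet_halt n)
  intro S hS
  have : A.outcome ⁻¹' S =
      ({ω | ∀ n, ¬ A.HaltsAt ω n} ∩ {_ω | (Sum.inl () : Outcome K X) ∈ S}) ∪
      ⋃ n : ℕ, ({ω | A.HaltsAt ω n} ∩ ⋂ m : Fin n, {ω | A.HaltsAt ω m}ᶜ) ∩
        {ω | A.outcomeAt n (ω.1, A.transcript ω n) ∈ S} := by
    ext ω
    by_cases h : ∃ n, A.HaltsAt ω n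
    · have hn : ¬ ∀ n, ¬ A.HaltsAt ω n := by push Not; exact h
      simp only [Set.mem_preimage, outcome, dif_pos h, Set.mem_union, Set.mem_inter_iff,
        Set.mem_ofPred_eq, hn, false_and, false_or, Set.mem_iUnion, Set.mem_iInter,
        Set.mem_compl_iff]
      constructor
      · intro hS
        exact ⟨Nat.find h, ⟨Nat.find_spec h, fun m => Nat.find_min h m.2⟩, hS⟩
      · rintro ⟨n, ⟨hn, hlt⟩, hS⟩
        have : Nat.find h = n := (Nat.find_eq_iff h).2 ⟨hn, fun m hm => hlt ⟨m, hm⟩⟩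
        rw [this]
        exact hS
    · have hn : ∀ n, ¬ A.HaltsAt ω n := by push Not at h; exact h
      simp [outcome, hn]
  rw [this]
  refine MeasurableSet.union (MeasurableSet.inter ?_ (MeasurableSet.const _)) ?_
  · have : {ω | ∀ n, ¬ A.HaltsAt ω n} = ⋂ n, {ω | A.HaltsAt ω n}ᶜ := by
      ext; simp
    rw [this]
    exact MeasurableSet.iInter fun n => (hH n).compl
  · exact MeasurableSet.iUnion fun n => ((hH n).inter (MeasurableSet.iInter fun m : Fin n =>
      (hH m).compl)).inter (hz n (A.measurable_outcomeAt n hS))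

/-- The law of an execution when candidate `i` has law `M i`: the seed and all tape entries are
independent, and the entry `(n, i)` has law `M i`. -/
def runLaw (M : Fin K → ProbabilityMeasure X) : ProbabilityMeasure A.Randomness :=
  ⟨(A.seedLaw : Measure A.Seed).prod
    (Measure.infinitePi fun _ : ℕ => Measure.pi fun i => (M i : Measure X)), inferInstance⟩

/-- The law of the output when candidate `i` has law `M i`. -/
def outputLaw (M : Fin K → ProbabilityMeasure X) : ProbabilityMeasure (Outcome K X) :=
  (A.runLaw M).map A.measurable_outcome.aemeasurable

/-- The expected number of oracle calls when candidate `i` has law `M i`. -/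
def expectedCalls (M : Fin K → ProbabilityMeasure X) : ℝ≥0∞ :=
  ∫⁻ ω, (A.calls ω : ℝ≥0∞) ∂(A.runLaw M : Measure A.Randomness)

end OracleAlgorithm

end PrivateSelection

end

/-! Call a uniformly random candidate, and let p_i be the probability that the score reaches i / R,
for i = 0, …, R + 1. This curve falls from p_0 = 1 to p_{R+1} = 0. Under ε₁-DP candidates every p_i
changes by a factor of at most e^{ε₁} between neighbours. If some candidate has median above i / R,
then p_i ≥ 1/(2K). Hence a level r with p_{r+1} < 2b, where b = 1/(4K), is high enough for (b). If
moreover p_r is not tiny, a sample reaching r / R is found in reasonable time.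

Such a level is found by an exponential mechanism on the curve clipped from below at m = b x², with
weight min(p_r / m, b / p_{r+1})^s. Where the curve crosses the geometric mean b x of m and b, the
weight is at least x^{-s} = (R + 1)/α. Levels with p_r ≤ m or p_{r+1} ≥ b have weight at most 1, so
together they get probability at most α (`sum_levelProb_le`). A multiplicative perturbation e^Δ of
the clipped curve costs e^{2sΔ} in privacy (`levelProb_le`). The curve is not known, but clipping
makes a relative error η achievable from about 1/(m η²) samples, by a Chernoff bound. An estimate
then costs the same as moving to a neighbouring dataset with ε₁ replaced by 2η. The price is paid
once on D and once on D', so that 2s(ε₁ + 4η) = ε₀ fixes s.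

Given the level, fresh trials are run until one is accepted; each trial also carries a coin of bias
γ whose heads means ⊥. The law of the first accepted trial is a truncated geometric sum times the
probability of an accepted output in the event. Each factor moves by at most e^{ε₁}, giving the 2ε₁
(`releaseProb_le`). The coin bounds the acceptance probability below by γ at every level, so that
truncation after N₂ trials costs at most (1 - γ)^{N₂}, and γ = β m / 4 keeps ⊥ rare at good levels.

The number of calls is the constant N₁ + N₂, so one estimate yields both bounds in (c), even without
their terms in 1/β and ln(1/ε₀)/β. If β + δ ≥ 1, the algorithm that outputs ⊥ at once suffices. -/

/-! ### The exponential mechanism for a level crossing -/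

namespace PrivateSelection

/-- The weight of level `r` for the level curve `p`: it is large if `p` is large at `r` and small
just above `r`. Values below `m` are treated as `m`. -/
noncomputable def levelWeight {R : ℕ} (m b s : ℝ) (p : Fin (R + 2) → ℝ) (r : Fin (R + 1)) : ℝ :=
  min (max m (p r.castSucc) / m) (b / max m (p r.succ)) ^ s

/-- The exponential mechanism with weights `levelWeight`. -/
noncomputable def levelProb {R : ℕ} (m b s : ℝ) (p : Fin (R + 2) → ℝ) (r : Fin (R + 1)) : ℝ :=
  levelWeight m b s p r / ∑ r', levelWeight m b s p r'

section Level

variable {R : ℕ} {m b s : ℝ} {p p' : Fin (R + 2) → ℝ}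

theorem levelWeight_pos (hm : 0 < m) (hb : 0 < b) (r : Fin (R + 1)) :
    0 < levelWeight m b s p r := by
  have h1 : 0 < max m (p r.castSucc) := lt_max_of_lt_left hm
  have h2 : 0 < max m (p r.succ) := lt_max_of_lt_left hm
  exact Real.rpow_pos_of_pos (lt_min (by positivity) (by positivity)) _

theorem sum_levelWeight_pos (hm : 0 < m) (hb : 0 < b) : 0 < ∑ r, levelWeight m b s p r :=
  Finset.sum_pos (fun r _ => levelWeight_pos hm hb r) Finset.univ_nonempty

theorem levelProb_nonneg (hm : 0 < m) (hb : 0 < b) (r : Fin (R + 1)) :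
    0 ≤ levelProb m b s p r :=
  div_nonneg (levelWeight_pos hm hb r).le (sum_levelWeight_pos hm hb).le

theorem sum_levelProb (hm : 0 < m) (hb : 0 < b) : ∑ r, levelProb m b s p r = 1 := by
  simp only [levelProb]
  rw [← Finset.sum_div, div_self (sum_levelWeight_pos hm hb).ne']

/-- The entry with `p` in the numerator uses `h`, and the one with `p` in the denominator uses `h'`;
so each entry of the minimum grows by at most `c`, and the power turns this into `c ^ s`. -/
theorem levelWeight_le (hm : 0 < m) (hb : 0 < b) (hs : 0 ≤ s) {c : ℝ} (hc : 0 < c)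
    (h : ∀ i, max m (p i) ≤ c * max m (p' i)) (h' : ∀ i, max m (p' i) ≤ c * max m (p i))
    (r : Fin (R + 1)) : levelWeight m b s p r ≤ c ^ s * levelWeight m b s p' r := by
  have h1 : 0 < max m (p r.castSucc) := lt_max_of_lt_left hm
  have h2 : 0 < max m (p r.succ) := lt_max_of_lt_left hm
  have h3 : 0 < max m (p' r.castSucc) := lt_max_of_lt_left hm
  have h4 : 0 < max m (p' r.succ) := lt_max_of_lt_left hm
  have h5 : 0 ≤ min (max m (p r.castSucc) / m) (b / max m (p r.succ)) :=
    le_min (by positivity) (by positivity)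
  have h6 : 0 ≤ min (max m (p' r.castSucc) / m) (b / max m (p' r.succ)) :=
    le_min (by positivity) (by positivity)
  unfold levelWeight
  rw [← Real.mul_rpow hc.le h6]
  refine Real.rpow_le_rpow h5 ?_ hs
  rw [mul_min_of_nonneg _ _ hc.le]
  refine min_le_min ?_ ?_
  · rw [← mul_div_assoc]
    exact div_le_div_of_nonneg_right (h _) hm.le
  · rw [← mul_div_assoc, div_le_div_iff₀ h2 h4]
    calc b * max m (p' r.succ) ≤ b * (c * max m (p r.succ)) :=
          mul_le_mul_of_nonneg_left (h' _) hb.le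
      _ = c * b * max m (p r.succ) := by ring

/-- The factor e^{sΔ} is lost twice, in the weight and in the normalizing sum. -/
theorem levelProb_le (hm : 0 < m) (hb : 0 < b) (hs : 0 ≤ s) {Δ : ℝ}
    (h : ∀ i, max m (p i) ≤ Real.exp Δ * max m (p' i))
    (h' : ∀ i, max m (p' i) ≤ Real.exp Δ * max m (p i)) (r : Fin (R + 1)) :
    levelProb m b s p r ≤ Real.exp (2 * s * Δ) * levelProb m b s p' r := by
  have hc := Real.exp_pos Δ
  have hw := levelWeight_le hm hb hs hc h h' r
  have hw' : ∑ i, levelWeight m b s p' i ≤ Real.exp Δ ^ s * ∑ i, levelWeight m b s p i := by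
    rw [Finset.mul_sum]
    exact Finset.sum_le_sum fun i _ => levelWeight_le hm hb hs hc h' h i
  have hp := sum_levelWeight_pos (s := s) (p := p) hm hb
  have hp' := sum_levelWeight_pos (s := s) (p := p') hm hb
  have h0 := levelWeight_pos (s := s) (p := p') hm hb r
  have he : Real.exp (2 * s * Δ) = Real.exp Δ ^ s * Real.exp Δ ^ s := by
    rw [← Real.exp_mul, ← Real.exp_add]
    congr 1
    ring
  unfold levelProb
  rw [he, ← mul_div_assoc, div_le_div_iff₀ hp hp']
  have := Real.rpow_pos_of_pos hc s
  calc _ ≤ (Real.exp Δ ^ s * levelWeight m b s p' r) *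
        (Real.exp Δ ^ s * ∑ i, levelWeight m b s p i) := by gcongr
    _ = _ := by ring

/-- If `p` starts high and ends low, then levels of weight at most `1` are rarely chosen. -/
theorem sum_levelProb_le {x α : ℝ} (hb : 0 < b) (hs : 0 ≤ s) (hx : 0 < x) (hx1 : x ≤ 1)
    (hm : m = b * x ^ 2) (hα : 0 < α) (hxs : x ^ s = α / (R + 1)) (h0 : b ≤ p 0)
    (hlast : p (Fin.last _) ≤ m) (B : Finset (Fin (R + 1)))
    (hB : ∀ r ∈ B, p r.castSucc ≤ m ∨ b ≤ p r.succ) :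
    ∑ r ∈ B, levelProb m b s p r ≤ α := by
  have hm0 : 0 < m := by rw [hm]; positivity
  -- A discrete intermediate value argument: `b * x` is the geometric mean of `m` and `b`, and the
  -- clipped curve starts above it and ends at `m`.
  have hcross : ∃ r : Fin (R + 1), b * x ≤ max m (p r.castSucc) ∧ max m (p r.succ) ≤ b * x := by
    by_contra! hcon
    have hall : ∀ i : Fin (R + 2), b * x ≤ max m (p i) := by
      intro i
      induction i using Fin.induction with
      | zero => exact le_max_of_le_right ((mul_le_of_le_one_right hb.le hx1).trans h0)
      | succ i ih => exact (hcon i ih).le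
    have := hcon (Fin.last R) (hall _)
    rw [Fin.succ_last, max_eq_left hlast, hm] at this
    nlinarith [mul_pos hb hx]
  obtain ⟨r₀, hr1, hr2⟩ := hcross
  have hbig : (R + 1) / α ≤ levelWeight m b s p r₀ := by
    have e : (R + 1) / α = (1 / x) ^ s := by
      rw [Real.div_rpow zero_le_one hx.le, Real.one_rpow, hxs, one_div_div]
    rw [e]
    refine Real.rpow_le_rpow (by positivity) (le_min ?_ ?_) hs
    · rw [div_le_div_iff₀ hx hm0]
      calc 1 * m = b * x * x := by rw [hm]; ring
        _ ≤ max m (p r₀.castSucc) * x := by gcongr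
    · rw [div_le_div_iff₀ hx (lt_max_of_lt_left hm0)]
      linarith
  have hsum : (R + 1) / α ≤ ∑ r, levelWeight m b s p r :=
    hbig.trans (Finset.single_le_sum (fun r _ => (levelWeight_pos hm0 hb r).le)
      (Finset.mem_univ r₀))
  have hsmall : ∑ r ∈ B, levelWeight m b s p r ≤ R + 1 := by
    calc ∑ r ∈ B, levelWeight m b s p r ≤ ∑ r ∈ B, 1 := by
          refine Finset.sum_le_sum fun r hr => ?_
          refine Real.rpow_le_one (le_min ?_ ?_) ?_ hs
          · have : 0 < max m (p r.castSucc) := lt_max_of_lt_left hm0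
            positivity
          · have : 0 < max m (p r.succ) := lt_max_of_lt_left hm0
            positivity
          · rcases hB r hr with h | h
            · refine min_le_of_left_le ?_
              rw [max_eq_left h, div_self hm0.ne']
            · exact min_le_of_right_le (div_le_one_of_le₀ (le_max_of_le_right h)
                (lt_max_of_lt_left hm0).le)
      _ = (B.card : ℝ) := by simp
      _ ≤ R + 1 := by
          have := Finset.card_le_univ B
          rw [Fintype.card_fin] at this
          exact_mod_cast this
  have hR : (0 : ℝ) < R + 1 := by positivity
  simp only [levelProb]
  rw [← Finset.sum_div, div_le_iff₀ (sum_levelWeight_pos hm0 hb)]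
  calc _ ≤ (R + 1 : ℝ) := hsmall
    _ = α * ((R + 1) / α) := by field_simp
    _ ≤ _ := by gcongr

end Level

/-! ### Mixtures of finite distributions -/

section Mixture

variable {H ι : Type*} [Fintype H] [Fintype ι] {π : H → ℝ} {q : H → ι → ℝ} {q₀ f : ι → ℝ}
  {B : Finset H} {c δ : ℝ}

/-- This exchanges the random table of counts for the true level curve: outside `B` the comparison
is pointwise, and since `f ≤ 1` the tables in `B` cost at most their mass. The next lemma is the
exchange in the opposite direction. -/
theorem sum_mul_mixture_le [DecidableEq H] (hπ : ∀ h, 0 ≤ π h) (hπ1 : ∑ h, π h = 1)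
    (hB : ∑ h ∈ B, π h ≤ δ)
    (hq : ∀ h r, 0 ≤ q h r) (hq1 : ∀ h, ∑ r, q h r = 1) (hq₀ : ∀ r, 0 ≤ q₀ r) (hc : 0 ≤ c)
    (hle : ∀ h ∉ B, ∀ r, q h r ≤ c * q₀ r) (hf : ∀ r, 0 ≤ f r) (hf1 : ∀ r, f r ≤ 1) :
    ∑ h, π h * ∑ r, q h r * f r ≤ c * ∑ r, q₀ r * f r + δ := by
  have h0 : 0 ≤ ∑ r, q₀ r * f r := Finset.sum_nonneg fun r _ => mul_nonneg (hq₀ r) (hf r)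
  rw [← Finset.sum_add_sum_compl B, add_comm]
  refine add_le_add ?_ (le_trans (Finset.sum_le_sum fun h _ => ?_) hB)
  · calc ∑ h ∈ Bᶜ, π h * ∑ r, q h r * f r ≤ ∑ h ∈ Bᶜ, π h * (c * ∑ r, q₀ r * f r) := by
          refine Finset.sum_le_sum fun h hh => mul_le_mul_of_nonneg_left ?_ (hπ h)
          rw [Finset.mul_sum]
          refine Finset.sum_le_sum fun r _ => ?_
          rw [← mul_assoc]
          exact mul_le_mul_of_nonneg_right (hle h (Finset.mem_compl.1 hh) r) (hf r)
      _ = (∑ h ∈ Bᶜ, π h) * (c * ∑ r, q₀ r * f r) := by rw [Finset.sum_mul]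
      _ ≤ 1 * (c * ∑ r, q₀ r * f r) := by
          refine mul_le_mul_of_nonneg_right ?_ (mul_nonneg hc h0)
          rw [← hπ1]
          exact Finset.sum_le_univ_sum_of_nonneg hπ
      _ = _ := one_mul _
  · refine mul_le_of_le_one_right (hπ h) ?_
    rw [← hq1 h]
    exact Finset.sum_le_sum fun r _ => mul_le_of_le_one_right (hq h r) (hf1 r)

theorem le_sum_mul_mixture [DecidableEq H] (hπ : ∀ h, 0 ≤ π h) (hπ1 : ∑ h, π h = 1)
    (hB : ∑ h ∈ B, π h ≤ δ)
    (hq : ∀ h r, 0 ≤ q h r) (hq₀ : ∀ r, 0 ≤ q₀ r) (hq₀1 : ∑ r, q₀ r = 1) (hc : 0 ≤ c)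
    (hle : ∀ h ∉ B, ∀ r, q₀ r ≤ c * q h r) (hf : ∀ r, 0 ≤ f r) (hf1 : ∀ r, f r ≤ 1) :
    ∑ r, q₀ r * f r ≤ c * (∑ h, π h * ∑ r, q h r * f r) + δ := by
  have h1 : ∑ r, q₀ r * f r ≤ 1 := by
    rw [← hq₀1]
    exact Finset.sum_le_sum fun r _ => mul_le_of_le_one_right (hq₀ r) (hf1 r)
  have hn : ∀ h, 0 ≤ ∑ r, q h r * f r := fun h =>
    Finset.sum_nonneg fun r _ => mul_nonneg (hq h r) (hf r)
  calc ∑ r, q₀ r * f r = ∑ h, π h * ∑ r, q₀ r * f r := by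
        rw [← Finset.sum_mul, hπ1, one_mul]
    _ = ∑ h ∈ Bᶜ, π h * ∑ r, q₀ r * f r + ∑ h ∈ B, π h * ∑ r, q₀ r * f r :=
        (Finset.sum_compl_add_sum B _).symm
    _ ≤ ∑ h ∈ Bᶜ, c * (π h * ∑ r, q h r * f r) + ∑ h ∈ B, π h := by
        refine add_le_add (Finset.sum_le_sum fun h hh => ?_) (Finset.sum_le_sum fun h _ => ?_)
        · rw [mul_left_comm]
          refine mul_le_mul_of_nonneg_left ?_ (hπ h)
          rw [Finset.mul_sum]
          refine Finset.sum_le_sum fun r _ => ?_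
          rw [← mul_assoc]
          exact mul_le_mul_of_nonneg_right (hle h (Finset.mem_compl.1 hh) r) (hf r)
        · exact mul_le_of_le_one_right (hπ h) h1
    _ ≤ c * (∑ h, π h * ∑ r, q h r * f r) + δ := by
        refine add_le_add ?_ hB
        rw [← Finset.mul_sum]
        exact mul_le_mul_of_nonneg_left (Finset.sum_le_univ_sum_of_nonneg fun h =>
          mul_nonneg (hπ h) (hn h)) hc

end Mixture

/-! ### Truncated geometric sums -/

/-- If `a' ≤ a`, the sums compare termwise. Otherwise multiply by `a'`: as `a` times its sum is `1 -
(1 - a) ^ N`, which increases with `a`, the factor e^ε is needed only to replace `a'` by `a`. Thus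
truncation does not worsen the ratio of 1/a to 1/a'. -/
theorem geomSum_le_exp_mul {a a' ε : ℝ} (N : ℕ) (ha1 : a ≤ 1) (ha' : 0 < a')
    (ha1' : a' ≤ 1) (hε : 0 ≤ ε) (h' : a' ≤ Real.exp ε * a) :
    ∑ j ∈ Finset.range N, (1 - a) ^ j ≤ Real.exp ε * ∑ j ∈ Finset.range N, (1 - a') ^ j := by
  have hs : ∀ a : ℝ, a * ∑ j ∈ Finset.range N, (1 - a) ^ j = 1 - (1 - a) ^ N := fun a => by
    simpa using mul_neg_geom_sum (1 - a) N
  have hn : 0 ≤ ∑ j ∈ Finset.range N, (1 - a') ^ j :=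
    Finset.sum_nonneg fun j _ => pow_nonneg (by linarith) _
  rcases le_total a' a with hle | hle
  · calc ∑ j ∈ Finset.range N, (1 - a) ^ j ≤ ∑ j ∈ Finset.range N, (1 - a') ^ j :=
          Finset.sum_le_sum fun j _ => pow_le_pow_left₀ (by linarith) (by linarith) _
      _ ≤ _ := le_mul_of_one_le_left hn (Real.one_le_exp hε)
  · refine le_of_mul_le_mul_left ?_ ha'
    calc a' * ∑ j ∈ Finset.range N, (1 - a) ^ j
        ≤ Real.exp ε * a * ∑ j ∈ Finset.range N, (1 - a) ^ j := by gcongr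
      _ = Real.exp ε * (1 - (1 - a) ^ N) := by rw [mul_assoc, hs]
      _ ≤ Real.exp ε * (1 - (1 - a') ^ N) := by
          have : (1 - a') ^ N ≤ (1 - a) ^ N :=
            pow_le_pow_left₀ (by linarith) (by linarith) _
          gcongr
      _ = a' * (Real.exp ε * ∑ j ∈ Finset.range N, (1 - a') ^ j) := by
          rw [← hs a']
          ring

theorem exp_sub_one_le_add_sq {t : ℝ} (h : |t| ≤ 1) : Real.exp t - 1 ≤ t + t ^ 2 := by
  have := Real.abs_exp_sub_one_sub_id_le h
  linarith [(abs_le.1 this).2]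

/-! ### Laws on finite types -/

section FiniteLaw

variable {α : Type*} [Fintype α] [MeasurableSpace α]

/-- The measure on a finite type with point masses `p`. -/
noncomputable def finiteLaw (p : α → ℝ) : Measure α :=
  ∑ a, ENNReal.ofReal (p a) • Measure.dirac a

theorem finiteLaw_apply (p : α → ℝ) {S : Set α} (hS : MeasurableSet S) :
    finiteLaw p S = ∑ a, ENNReal.ofReal (p a) * S.indicator 1 a := by
  simp [finiteLaw, Measure.dirac_apply' _ hS]

theorem isProbabilityMeasure_finiteLaw {p : α → ℝ} (hp : ∀ a, 0 ≤ p a) (h1 : ∑ a, p a = 1) :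
    IsProbabilityMeasure (finiteLaw p) := by
  refine ⟨?_⟩
  rw [finiteLaw_apply p MeasurableSet.univ]
  simp only [Set.indicator_univ, Pi.one_apply, mul_one]
  rw [← ENNReal.ofReal_sum_of_nonneg fun a _ => hp a, h1, ENNReal.ofReal_one]

instance isFiniteMeasure_finiteLaw (p : α → ℝ) : IsFiniteMeasure (finiteLaw p) := by
  refine ⟨?_⟩
  rw [finiteLaw_apply p MeasurableSet.univ]
  simp [ENNReal.sum_lt_top]

theorem finiteLaw_real_singleton [MeasurableSingletonClass α] {p : α → ℝ} (hp : ∀ a, 0 ≤ p a)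
    (a : α) : (finiteLaw p).real {a} = p a := by
  classical
  rw [Measure.real, finiteLaw_apply p (measurableSet_singleton a), Finset.sum_eq_single a]
  · simp [hp a]
  · intro b _ hb
    simp [hb]
  · simp

theorem finiteLaw_prod_real [MeasurableSingletonClass α] {β : Type*} [MeasurableSpace β]
    (μ : Measure β) [IsProbabilityMeasure μ] {p : α → ℝ} (hp : ∀ a, 0 ≤ p a) {S : Set (α × β)}
    (hS : MeasurableSet S) :
    ((finiteLaw p).prod μ).real S = ∑ a, p a * μ.real {b | (a, b) ∈ S} := by
  classical
  have hd : S = ⋃ a ∈ (Finset.univ : Finset α), ({a} ×ˢ {b | (a, b) ∈ S}) := by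
    ext ⟨a, b⟩
    simp
  have hm : ∀ a : α, MeasurableSet {b | (a, b) ∈ S} := fun a => measurable_prodMk_left hS
  conv_lhs => rw [hd]
  rw [measureReal_biUnion_finset]
  · refine Finset.sum_congr rfl fun a _ => ?_
    rw [measureReal_prod_prod, finiteLaw_real_singleton hp]
  · intro a _ b _ hab
    refine Set.disjoint_left.2 ?_
    rintro ⟨x, y⟩ ⟨hx, -⟩ ⟨hx', -⟩
    exact hab ((Set.mem_singleton_iff.1 hx).symm.trans (Set.mem_singleton_iff.1 hx'))
  · exact fun a _ => (measurableSet_singleton a).prod (hm a)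

end FiniteLaw

/-! ### The first accepted sample -/

section FirstAccepted

variable {W Y : Type*} {N : ℕ}

/-- `g` of the first accepted entry, or `y₀` if there is none. -/
def firstAccepted (acc : W → Bool) (g : W → Y) (y₀ : Y) (w : Fin N → W) : Y :=
  match Fin.find? fun j => acc (w j) with
  | none => y₀
  | some j => g (w j)

/-- Splitting by the position of the first accepted entry gives disjoint boxes, whose mass under a
product measure is a product. -/
theorem preimage_firstAccepted (acc : W → Bool) (g : W → Y) (y₀ : Y) (S : Set Y) :
    firstAccepted (N := N) acc g y₀ ⁻¹' S =
      (⋃ j ∈ (Finset.univ : Finset (Fin N)), Set.univ.pi fun k =>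
        if k < j then {w | acc w = false} else
          if k = j then {w | acc w = true ∧ g w ∈ S} else Set.univ) ∪
      {w | (∀ j, acc (w j) = false) ∧ y₀ ∈ S} := by
  ext w
  simp only [Set.mem_preimage, Set.mem_union, Set.mem_iUnion, Set.mem_pi, Set.mem_univ,
    Set.mem_ofPred_eq, forall_const, Finset.mem_univ, exists_const]
  have key : ∀ j, (∀ k, w k ∈ (if k < j then {w | acc w = false} else
      if k = j then {w | acc w = true ∧ g w ∈ S} else Set.univ)) ↔
      (acc (w j) = true ∧ ∀ k < j, acc (w k) = false) ∧ g (w j) ∈ S := by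
    intro j
    constructor
    · intro h
      have hj := h j
      simp only [lt_irrefl, if_false, if_true] at hj
      refine ⟨⟨hj.1, fun k hk => ?_⟩, hj.2⟩
      have := h k
      rwa [if_pos hk] at this
    · rintro ⟨⟨h1, h2⟩, h3⟩ k
      split_ifs with hk hk'
      · exact h2 k hk
      · subst hk'; exact ⟨h1, h3⟩
      · trivial
  simp only [key, ← Fin.find?_eq_some_iff (p := fun j => acc (w j)),
    ← Fin.find?_eq_none_iff (p := fun j => acc (w j))]
  unfold firstAccepted
  cases h : Fin.find? fun j => acc (w j) with
  | none => simp
  | some j => simp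

variable [MeasurableSpace W]

theorem measurableSet_acc_false {acc : W → Bool} (hacc : Measurable acc) :
    MeasurableSet {w | acc w = false} := hacc (measurableSet_singleton false)

theorem measurableSet_acc_and [MeasurableSpace Y] {acc : W → Bool} (hacc : Measurable acc)
    {g : W → Y} (hg : Measurable g) {S : Set Y} (hS : MeasurableSet S) :
    MeasurableSet {w | acc w = true ∧ g w ∈ S} :=
  (hacc (measurableSet_singleton true)).inter (hg hS)

theorem measurableSet_firstAccepted_box [MeasurableSpace Y] {acc : W → Bool}
    (hacc : Measurable acc) {g : W → Y} (hg : Measurable g) {S : Set Y} (hS : MeasurableSet S)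
    (j : Fin N) :
    MeasurableSet (Set.univ.pi fun k : Fin N =>
        if k < j then {w | acc w = false} else
          if k = j then {w | acc w = true ∧ g w ∈ S} else Set.univ) := by
  refine MeasurableSet.univ_pi fun k => ?_
  split_ifs
  · exact measurableSet_acc_false hacc
  · exact measurableSet_acc_and hacc hg hS
  · exact MeasurableSet.univ

theorem measurableSet_all_rejected {acc : W → Bool} (hacc : Measurable acc)
    (y₀ : Y) (S : Set Y) :
    MeasurableSet {w : Fin N → W | (∀ j, acc (w j) = false) ∧ y₀ ∈ S} := by
  have : {w : Fin N → W | (∀ j, acc (w j) = false) ∧ y₀ ∈ S} =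
      (⋂ j, {w | acc (w j) = false}) ∩ {_w | y₀ ∈ S} := by
    ext; simp
  rw [this]
  refine MeasurableSet.inter (MeasurableSet.iInter fun j => ?_) (MeasurableSet.const _)
  exact (hacc.comp (measurable_pi_apply j)) (measurableSet_singleton false)

theorem measurable_firstAccepted [MeasurableSpace Y] {acc : W → Bool} (hacc : Measurable acc)
    {g : W → Y} (hg : Measurable g) (y₀ : Y) :
    Measurable (firstAccepted (N := N) acc g y₀) := by
  intro S hS
  rw [preimage_firstAccepted]
  exact (Finset.measurableSet_biUnion _ fun j _ =>
    measurableSet_firstAccepted_box hacc hg hS j).union (measurableSet_all_rejected hacc y₀ S)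

open Classical in
theorem measureReal_firstAccepted [MeasurableSpace Y] (μ : Measure W) [IsProbabilityMeasure μ]
    {acc : W → Bool} (hacc : Measurable acc) {g : W → Y} (hg : Measurable g) (y₀ : Y) {S : Set Y}
    (hS : MeasurableSet S) :
    (Measure.pi fun _ : Fin N => μ).real (firstAccepted acc g y₀ ⁻¹' S) =
      (∑ j ∈ Finset.range N, (1 - μ.real {w | acc w = true}) ^ j) *
        μ.real {w | acc w = true ∧ g w ∈ S} +
      (1 - μ.real {w | acc w = true}) ^ N * (if y₀ ∈ S then 1 else 0) := by
  have hpi : ∀ s : Fin N → Set W,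
      (Measure.pi fun _ : Fin N => μ).real (Set.univ.pi s) = ∏ j, μ.real (s j) := by
    intro s
    simp [Measure.real, Measure.pi_pi, ENNReal.toReal_prod]
  have hrej : μ.real {w | acc w = false} = 1 - μ.real {w | acc w = true} := by
    have hc : {w | acc w = false} = {w | acc w = true}ᶜ := by ext; simp
    rw [hc, probReal_compl_eq_one_sub (μ := μ) (s := {w | acc w = true})
      (hacc (measurableSet_singleton true))]
  rw [preimage_firstAccepted, measureReal_union ?_ (measurableSet_all_rejected hacc y₀ S)
    (measure_ne_top _ _) (measure_ne_top _ _), measureReal_biUnion_finset]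
  · congr 1
    · rw [Finset.sum_mul, ← Fin.sum_univ_eq_sum_range (fun j =>
        (1 - μ.real {w | acc w = true}) ^ j * μ.real {w | acc w = true ∧ g w ∈ S})]
      refine Finset.sum_congr rfl fun j _ => ?_
      rw [hpi]
      have hfac : ∀ k : Fin N, μ.real (if k < j then {w | acc w = false} else
          if k = j then {w | acc w = true ∧ g w ∈ S} else Set.univ) =
          (if k < j then 1 - μ.real {w | acc w = true} else 1) *
          (if k = j then μ.real {w | acc w = true ∧ g w ∈ S} else 1) := by
        intro k
        split_ifs with h1 h2
        · exact absurd h2 h1.ne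
        · rw [hrej, mul_one]
        · rw [one_mul]
        · simp
      simp only [hfac]
      rw [Finset.prod_mul_distrib, Finset.prod_ite_eq' Finset.univ j, if_pos (Finset.mem_univ j),
        Finset.prod_ite, Finset.prod_const_one, mul_one, Finset.prod_const]
      congr 2
      rw [show (Finset.univ.filter fun k : Fin N => k < j) = Finset.Iio j by ext; simp,
        Fin.card_Iio]
    · by_cases hy : y₀ ∈ S
      · simp only [hy, and_true, if_true, mul_one]
        rw [show {w : Fin N → W | ∀ j, acc (w j) = false} =
          Set.univ.pi fun _ => {w | acc w = false} by ext; simp, hpi]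
        simp [hrej]
      · simp [hy]
  · intro i _ j _ hij
    refine Set.disjoint_left.2 fun w h1 h2 => ?_
    rcases lt_trichotomy i j with h | h | h
    · have a1 := h1 i trivial
      have a2 := h2 i trivial
      simp only [lt_irrefl, if_false, if_true, if_pos h, Set.mem_ofPred_eq] at a1 a2
      rw [a2] at a1
      exact absurd a1.1 (by simp)
    · exact hij h
    · have a1 := h1 j trivial
      have a2 := h2 j trivial
      simp only [lt_irrefl, if_false, if_true, if_pos h, Set.mem_ofPred_eq] at a1 a2
      rw [a1] at a2
      exact absurd a2.1 (by simp)
  · exact fun j _ => measurableSet_firstAccepted_box hacc hg hS j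
  · refine Set.disjoint_left.2 fun w h1 h2 => ?_
    simp only [Set.mem_iUnion] at h1
    obtain ⟨j, -, hj⟩ := h1
    have := hj j trivial
    simp only [lt_irrefl, if_false, if_true, Set.mem_ofPred_eq] at this
    rw [h2.1 j] at this
    exact absurd this.1 (by simp)

end FirstAccepted

/-! ### A multiplicative Chernoff bound -/

section Chernoff

variable {Z : Type*} [MeasurableSpace Z] (ν : Measure Z) [IsProbabilityMeasure ν] {A : Set Z}

open Classical in
theorem integral_exp_indicator_le (hA : MeasurableSet A) {t : ℝ} (ht : |t| ≤ 1) :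
    ∫ z, Real.exp (t * A.indicator 1 z) ∂ν ≤ Real.exp (ν.real A * (t + t ^ 2)) := by
  have h1 : ∀ z, Real.exp (t * A.indicator 1 z) =
      1 + A.indicator (fun _ => Real.exp t - 1) z := by
    intro z
    by_cases hz : z ∈ A <;> simp [hz]
  simp only [h1]
  rw [integral_add (integrable_const _) ((integrable_const _).indicator hA),
    integral_indicator_const _ hA]
  simp only [integral_const, probReal_univ, smul_eq_mul, mul_one]
  calc 1 + ν.real A * (Real.exp t - 1) ≤ 1 + ν.real A * (t + t ^ 2) := by
        have := exp_sub_one_le_add_sq ht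
        gcongr
    _ ≤ _ := by linarith [Real.add_one_le_exp (ν.real A * (t + t ^ 2))]

variable {N : ℕ}

open Classical in
-- The exponential moment method, with `t` of either sign so that both tails are covered; it uses
-- e^t - 1 ≤ t + t² on [-1, 1].
theorem measureReal_count_deviation_le_exp (hA : MeasurableSet A) {t d : ℝ} (ht : |t| ≤ 1) :
    (Measure.pi fun _ : Fin N => ν).real
        {y | d ≤ t * (((Finset.univ.filter fun n => y n ∈ A).card : ℝ) - N * ν.real A)} ≤
      Real.exp (N * ν.real A * t ^ 2 - d) := by
  set μ := Measure.pi fun _ : Fin N => ν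
  set p := ν.real A
  have hprod : ∀ y : Fin N → Z, Real.exp (t * ((Finset.univ.filter fun n => y n ∈ A).card : ℝ)) =
      ∏ n, Real.exp (t * A.indicator 1 (y n)) := by
    intro y
    rw [← Real.exp_sum, ← Finset.mul_sum]
    congr 2
    simp [Set.indicator_apply]
  have hmeas : Measurable fun z => Real.exp (t * A.indicator 1 z) :=
    Real.measurable_exp.comp ((measurable_one.indicator hA).const_mul t)
  have hint : Integrable (fun y : Fin N → Z => ∏ n, Real.exp (t * A.indicator 1 (y n))) μ := by
    refine Integrable.of_bound (C := Real.exp |t| ^ N) ?_ ?_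
    · exact (Finset.measurable_prod _ fun n _ =>
        hmeas.comp (measurable_pi_apply n)).aestronglyMeasurable
    · refine Filter.Eventually.of_forall fun y => ?_
      rw [Real.norm_of_nonneg (Finset.prod_nonneg fun _ _ => (Real.exp_pos _).le)]
      calc ∏ n, Real.exp (t * A.indicator 1 (y n)) ≤ ∏ _n : Fin N, Real.exp |t| := by
            refine Finset.prod_le_prod (fun _ _ => (Real.exp_pos _).le) fun n _ => ?_
            refine Real.exp_le_exp.2 ?_
            by_cases hz : y n ∈ A <;> simp [hz, le_abs_self]
        _ = _ := by simp
  have hmarkov := mul_meas_ge_le_integral_of_nonneg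
    (Filter.Eventually.of_forall fun y => Finset.prod_nonneg fun _ _ => (Real.exp_pos _).le)
    hint (Real.exp (t * (N * p) + d))
  have hI : ∫ y, ∏ n, Real.exp (t * A.indicator 1 (y n)) ∂μ ≤
      Real.exp (N * (p * (t + t ^ 2))) := by
    rw [integral_fintype_prod_eq_prod (fun (_ : Fin N) z => Real.exp (t * A.indicator 1 z))]
    rw [Finset.prod_const, Finset.card_univ, Fintype.card_fin, Real.exp_nat_mul]
    exact pow_le_pow_left₀ (integral_nonneg fun _ => (Real.exp_pos _).le)
      (integral_exp_indicator_le ν hA ht) _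
  have hset : {y : Fin N → Z | d ≤ t * (((Finset.univ.filter fun n => y n ∈ A).card : ℝ) - N * p)}
      = {y | Real.exp (t * (N * p) + d) ≤ ∏ n, Real.exp (t * A.indicator 1 (y n))} := by
    ext y
    simp only [Set.mem_ofPred_eq, ← hprod, Real.exp_le_exp]
    constructor <;> intro h <;> linarith
  rw [hset]
  refine le_of_mul_le_mul_left (hmarkov.trans (hI.trans_eq ?_)) (Real.exp_pos _)
  rw [← Real.exp_add]
  congr 1
  ring

open Classical in
-- Taking `t = ±η / 2` balances the two terms of the exponent. The scale `v` may exceed the true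
-- probability: it will be the clipped probability, so that rare levels need not be estimated to
-- relative precision.
theorem measureReal_abs_count_deviation_le (hA : MeasurableSet A) {η v : ℝ} (hη : 0 < η)
    (hη1 : η ≤ 1) (hv : ν.real A ≤ v) :
    (Measure.pi fun _ : Fin N => ν).real
        {y | N * (η * v) ≤ |((Finset.univ.filter fun n => y n ∈ A).card : ℝ) - N * ν.real A|} ≤
      2 * Real.exp (-(N * v * η ^ 2 / 4)) := by
  have h1 := measureReal_count_deviation_le_exp (N := N) ν hA (t := η / 2)
    (d := η / 2 * (N * (η * v))) (by rw [abs_of_pos] <;> linarith)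
  have h2 := measureReal_count_deviation_le_exp (N := N) ν hA (t := -(η / 2))
    (d := η / 2 * (N * (η * v))) (by rw [abs_neg, abs_of_pos] <;> linarith)
  have hb : N * ν.real A * (η / 2) ^ 2 - η / 2 * (N * (η * v)) ≤ -(N * v * η ^ 2 / 4) := by
    have : N * ν.real A * (η / 2) ^ 2 ≤ N * v * (η / 2) ^ 2 := by gcongr
    linarith
  rw [neg_sq] at h2
  have hsub : {y : Fin N → Z | N * (η * v) ≤
      |((Finset.univ.filter fun n => y n ∈ A).card : ℝ) - N * ν.real A|} ⊆
      {y | η / 2 * (N * (η * v)) ≤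
        η / 2 * (((Finset.univ.filter fun n => y n ∈ A).card : ℝ) - N * ν.real A)} ∪
      {y | η / 2 * (N * (η * v)) ≤
        -(η / 2) * (((Finset.univ.filter fun n => y n ∈ A).card : ℝ) - N * ν.real A)} := by
    intro y hy
    rcases le_abs'.1 (Set.mem_ofPred.1 hy) with h | h
    · right
      simp only [Set.mem_ofPred_eq]
      nlinarith
    · left
      simp only [Set.mem_ofPred_eq]
      gcongr
  calc _ ≤ _ := measureReal_mono hsub
    _ ≤ _ := measureReal_union_le _ _
    _ ≤ Real.exp (-(N * v * η ^ 2 / 4)) + Real.exp (-(N * v * η ^ 2 / 4)) :=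
        add_le_add (h1.trans (Real.exp_le_exp.2 hb)) (h2.trans (Real.exp_le_exp.2 hb))
    _ = _ := by ring

end Chernoff

/-! ### Algorithms with a fixed number of non-adaptive calls -/

namespace OracleAlgorithm

section FixedCalls

variable {K : ℕ} {X : Type v} [MeasurableSpace X]

/-- The algorithm that makes exactly `N` calls, to the candidates `idx s 0, …, idx s (N - 1)`
prescribed by the seed `s`, and then releases the sample selected by `rel`. -/
noncomputable def ofFixedCalls (hK : 0 < K) (N : ℕ) (S : Type) [MeasurableSpace S]
    (law : ProbabilityMeasure S)
    (idx : Fin N → S → Fin K) (hidx : ∀ j, Measurable (idx j))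
    (rel : S × Transcript K X N → Option (Fin N)) (hrel : ∀ a, MeasurableSet {z | rel z = a}) :
    OracleAlgorithm K X where
  Seed := S
  seedLaw := law
  halt n := {_z | N ≤ n}
  query n z := if h : n < N then idx ⟨n, h⟩ z.1 else ⟨0, hK⟩
  release n := if h : n = N then h ▸ rel else fun _ => none
  measurableSet_halt _ := MeasurableSet.const _
  measurable_query n := by
    by_cases h : n < N
    · simp only [h, dif_pos]
      exact (hidx _).comp measurable_fst
    · simp only [h, dif_neg, not_false_eq_true]
      exact measurable_const
  measurableSet_release n a := by
    by_cases h : n = N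
    · subst h
      simpa using hrel a
    · simp only [h, dif_neg, not_false_eq_true]
      exact MeasurableSet.const _

variable (hK : 0 < K) (N : ℕ) (S : Type) [MeasurableSpace S] (law : ProbabilityMeasure S)
    (idx : Fin N → S → Fin K) (hidx : ∀ j, Measurable (idx j))
    (rel : S × Transcript K X N → Option (Fin N)) (hrel : ∀ a, MeasurableSet {z | rel z = a})

theorem ofFixedCalls_haltsAt (ω : (ofFixedCalls hK N S law idx hidx rel hrel).Randomness) (n : ℕ) :
    (ofFixedCalls hK N S law idx hidx rel hrel).HaltsAt ω n ↔ N ≤ n := Iff.rfl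

theorem ofFixedCalls_calls (ω : (ofFixedCalls hK N S law idx hidx rel hrel).Randomness) :
    (ofFixedCalls hK N S law idx hidx rel hrel).calls ω = N := by
  simp only [calls, ofFixedCalls_haltsAt]
  refine le_antisymm (iInf₂_le N le_rfl) (le_iInf₂ fun n hn => ?_)
  exact_mod_cast hn

theorem ofFixedCalls_expectedCalls (M : Fin K → ProbabilityMeasure X) :
    (ofFixedCalls hK N S law idx hidx rel hrel).expectedCalls M = N := by
  simp [expectedCalls, ofFixedCalls_calls]

theorem ofFixedCalls_transcript (ω : S × (ℕ → Fin K → X)) :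
    (ofFixedCalls hK N S law idx hidx rel hrel).transcript ω N =
      fun j => (idx j ω.1, ω.2 j (idx j ω.1)) := by
  set A := ofFixedCalls hK N S law idx hidx rel hrel
  -- The induction needs all prefixes; the default candidate in the `else` branches is never called
  -- for `n ≤ N`.
  have key : ∀ n, n ≤ N → A.transcript ω n = fun j : Fin n =>
      (if h : (j : ℕ) < N then idx ⟨j, h⟩ ω.1 else ⟨0, hK⟩,
        ω.2 j (if h : (j : ℕ) < N then idx ⟨j, h⟩ ω.1 else ⟨0, hK⟩)) := by
    intro n
    induction n with
    | zero =>
      intro _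
      funext j
      exact j.elim0
    | succ n ih =>
      intro hn
      funext j
      refine Fin.lastCases ?_ (fun j => ?_) j
      · simp only [transcript, Fin.snoc_last]
        rfl
      · simp only [transcript, Fin.snoc_castSucc, ih (by omega)]
        rfl
  rw [key N le_rfl]
  funext j
  simp [j.2]

theorem ofFixedCalls_outcome (ω : S × (ℕ → Fin K → X)) :
    (ofFixedCalls hK N S law idx hidx rel hrel).outcome ω =
      (rel (ω.1, fun j => (idx j ω.1, ω.2 j (idx j ω.1)))).elim (Sum.inl ())
        fun j => Sum.inr (idx j ω.1, ω.2 j (idx j ω.1)) := by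
  classical
  set A := ofFixedCalls hK N S law idx hidx rel hrel with hA
  have h : ∃ n, A.HaltsAt ω n := ⟨N, le_refl N⟩
  have hfind : Nat.find h = N := (Nat.find_eq_iff h).2 ⟨le_refl N, fun n hn hn' => by
    have : N ≤ n := hn'
    omega⟩
  have ho : A.outcome ω = A.outcomeAt (Nat.find h) (ω.1, A.transcript ω (Nat.find h)) := by
    unfold outcome
    exact (dif_pos h).trans (by congr!)
  rw [ho, hfind, ofFixedCalls_transcript]
  have hr : A.release N = rel := by
    exact dif_pos rfl
  have hmatch : ∀ (o : Option (Fin N)) (tr : Transcript K X N),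
      (match o with
        | none => Sum.inl ()
        | some j => Sum.inr (tr j) : Outcome K X) = o.elim (Sum.inl ()) fun j => Sum.inr (tr j) :=
    fun o _ => by cases o <;> rfl
  unfold outcomeAt
  rw [hr]
  exact hmatch _ _

end FixedCalls

end OracleAlgorithm

/-! ### The law of one trial -/

section Trial

variable {K : ℕ} {X : Type v} [MeasurableSpace X]

/-- A trial: a coin, and a call to some candidate together with its answer. -/
abbrev Trial (K : ℕ) (X : Type v) : Type v := Bool × (Fin K × X)

/-- Assemble a trial from the coin, the index of the called candidate and the tape. -/
def readTrial (z : (Bool × Fin K) × (Fin K → X)) : Trial K X := (z.1.1, z.1.2, z.2 z.1.2)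

/-- The coin is heads with probability `γ`, and the candidate is uniform. -/
noncomputable def coinProb (K : ℕ) (γ : ℝ) (s : Bool × Fin K) : ℝ :=
  (if s.1 then γ else 1 - γ) / K

theorem coinProb_nonneg {γ : ℝ} (h0 : 0 ≤ γ) (h1 : γ ≤ 1) (s : Bool × Fin K) :
    0 ≤ coinProb K γ s := by
  refine div_nonneg ?_ (Nat.cast_nonneg _)
  split_ifs <;> linarith

theorem sum_coinProb (hK : 0 < K) (γ : ℝ) : ∑ s, coinProb K γ s = 1 := by
  have : (K : ℝ) ≠ 0 := by positivity
  rw [Fintype.sum_prod_type]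
  simp [coinProb]
  field_simp
  ring

theorem measurable_readTrial : Measurable (readTrial : _ → Trial K X) := by
  have h2 : Measurable fun p : (Fin K → X) × Fin K => p.1 p.2 :=
    measurable_from_prod_countable_left fun i => measurable_pi_apply i
  exact (measurable_fst.comp measurable_fst).prodMk ((measurable_snd.comp measurable_fst).prodMk
    (h2.comp (measurable_snd.prodMk (measurable_snd.comp measurable_fst))))

/-- The law of a trial. -/
noncomputable def trialLaw (γ : ℝ) (M : Fin K → ProbabilityMeasure X) : Measure (Trial K X) :=
  ((finiteLaw (coinProb K γ)).prod (Measure.pi fun i => (M i : Measure X))).map readTrial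

theorem isProbabilityMeasure_trialLaw (hK : 0 < K) {γ : ℝ} (h0 : 0 ≤ γ) (h1 : γ ≤ 1)
    (M : Fin K → ProbabilityMeasure X) : IsProbabilityMeasure (trialLaw γ M) := by
  have := isProbabilityMeasure_finiteLaw (coinProb_nonneg (K := K) h0 h1) (sum_coinProb hK γ)
  exact Measure.isProbabilityMeasure_map measurable_readTrial.aemeasurable

/-- Only the tape entry of the called candidate is read, so its marginal alone enters, and a trial
is a mixture over coins and candidates. Bounds on the ratio of candidate laws therefore pass to
trials. -/
theorem trialLaw_real {γ : ℝ} (h0 : 0 ≤ γ) (h1 : γ ≤ 1) (M : Fin K → ProbabilityMeasure X)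
    {S : Set (Trial K X)} (hS : MeasurableSet S) :
    (trialLaw γ M).real S =
      ∑ s, coinProb K γ s * (M s.2 : Measure X).real {x | (s.1, s.2, x) ∈ S} := by
  rw [trialLaw, map_measureReal_apply measurable_readTrial hS,
    finiteLaw_prod_real _ (coinProb_nonneg h0 h1) (measurable_readTrial hS)]
  refine Finset.sum_congr rfl fun s _ => ?_
  congr 1
  have hm : MeasurableSet {x | (s.1, s.2, x) ∈ S} :=
    (measurable_const.prodMk (measurable_const.prodMk measurable_id)) hS
  exact (measurePreserving_eval (fun i => (M i : Measure X)) s.2).measureReal_preimage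
    hm.nullMeasurableSet

theorem trialLaw_real_le {γ : ℝ} (h0 : 0 ≤ γ) (h1 : γ ≤ 1) {M M' : Fin K → ProbabilityMeasure X}
    {c : ℝ} (h : ∀ i, ∀ S, MeasurableSet S → (M i : Measure X).real S ≤
      c * (M' i : Measure X).real S) {S : Set (Trial K X)} (hS : MeasurableSet S) :
    (trialLaw γ M).real S ≤ c * (trialLaw γ M').real S := by
  rw [trialLaw_real h0 h1 M hS, trialLaw_real h0 h1 M' hS, Finset.mul_sum]
  refine Finset.sum_le_sum fun s _ => ?_
  have hm : MeasurableSet {x | (s.1, s.2, x) ∈ S} :=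
    (measurable_const.prodMk (measurable_const.prodMk measurable_id)) hS
  calc _ ≤ coinProb K γ s * (c * (M' s.2 : Measure X).real {x | (s.1, s.2, x) ∈ S}) :=
        mul_le_mul_of_nonneg_left (h _ _ hm) (coinProb_nonneg h0 h1 s)
    _ = _ := by ring

end Trial

/-! ### Independent trials from seed and tape -/

theorem measurePreserving_infinitePi_comp {J V : Type*} [Fintype J] [MeasurableSpace V]
    (ν : Measure V) [IsProbabilityMeasure ν] {e : J → ℕ} (he : Function.Injective e) :
    MeasurePreserving (fun (t : ℕ → V) j => t (e j)) (Measure.infinitePi fun _ : ℕ => ν)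
      (Measure.pi fun _ : J => ν) := by
  classical
  have hm : Measurable fun (t : ℕ → V) (j : J) => t (e j) :=
    measurable_pi_lambda _ fun j => measurable_pi_apply _
  refine ⟨hm, (Measure.pi_eq fun s hs => ?_).symm⟩
  rw [Measure.map_apply hm (MeasurableSet.univ_pi hs)]
  -- The preimage of a box is a cylinder over the range of `e`; `h.choose` inverts `e` there.
  have : (fun (t : ℕ → V) (j : J) => t (e j)) ⁻¹' Set.univ.pi s =
      ((Finset.univ.image e : Finset ℕ) : Set ℕ).pi
        (fun n => if h : ∃ j, e j = n then s h.choose else Set.univ) := by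
    ext t
    simp only [Set.mem_preimage, Set.mem_pi, Set.mem_univ, forall_const, Finset.coe_image,
      Finset.coe_univ, Set.image_univ, Set.forall_mem_range]
    refine forall_congr' fun j => ?_
    have h : ∃ j', e j' = e j := ⟨j, rfl⟩
    rw [dif_pos h, he h.choose_spec]
  rw [this, Measure.infinitePi_pi]
  · rw [Finset.prod_image (fun _ _ _ _ h => he h)]
    refine Finset.prod_congr rfl fun j _ => ?_
    have h : ∃ j', e j' = e j := ⟨j, rfl⟩
    rw [dif_pos h, he h.choose_spec]
  · intro n _
    split_ifs
    · exact hs _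
    · exact MeasurableSet.univ

/-- Since `e` is injective, each trial reads its own tape row together with its own part of the
seed. Hence the trials of both stages are i.i.d. and independent of the remaining seed, which holds
the choices of level. -/
theorem measurePreserving_trials {C V W U : Type*} [MeasurableSpace C] [MeasurableSpace V]
    [MeasurableSpace W] [MeasurableSpace U] {J₁ J₂ : Type*} [Fintype J₁] [Fintype J₂]
    (ρ : Measure C) [IsProbabilityMeasure ρ] (σ : Measure U) [IsProbabilityMeasure σ]
    (ν : Measure V) [IsProbabilityMeasure ν] {e : J₁ ⊕ J₂ → ℕ} (he : Function.Injective e)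
    {g : U × V → W} (hg : Measurable g) :
    MeasurePreserving
      (fun ω : (C × (J₁ ⊕ J₂ → U)) × (ℕ → V) =>
        (ω.1.1, (fun j => g (ω.1.2 (Sum.inl j), ω.2 (e (Sum.inl j)))),
          (fun j => g (ω.1.2 (Sum.inr j), ω.2 (e (Sum.inr j))))))
      ((ρ.prod (Measure.pi fun _ => σ)).prod (Measure.infinitePi fun _ => ν))
      (ρ.prod ((Measure.pi fun _ => (σ.prod ν).map g).prod
        (Measure.pi fun _ => (σ.prod ν).map g))) := by
  have : IsProbabilityMeasure ((σ.prod ν).map g) :=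
    Measure.isProbabilityMeasure_map hg.aemeasurable
  have h1 := (MeasurePreserving.id (ρ.prod (Measure.pi fun _ : J₁ ⊕ J₂ => σ))).prod
    (measurePreserving_infinitePi_comp ν he)
  have h2 := measurePreserving_prodAssoc ρ (Measure.pi fun _ : J₁ ⊕ J₂ => σ)
    (Measure.pi fun _ : J₁ ⊕ J₂ => ν)
  have h3 := (measurePreserving_arrowProdEquivProdArrow U V (J₁ ⊕ J₂) (fun _ => σ)
    (fun _ => ν)).symm
  have h4 : MeasurePreserving (fun (a : J₁ ⊕ J₂ → U × V) i => g (a i))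
      (Measure.pi fun _ => σ.prod ν) (Measure.pi fun _ => (σ.prod ν).map g) :=
    measurePreserving_pi _ _ fun _ => ⟨hg, rfl⟩
  have h5 := measurePreserving_sumPiEquivProdPi (X := fun _ : J₁ ⊕ J₂ => W)
    (fun _ => (σ.prod ν).map g)
  exact ((MeasurePreserving.id ρ).prod (h5.comp (h4.comp h3))).comp (h2.comp h1)

/-! ### The selection algorithm -/

section Selection

variable {K R N₁ N₂ : ℕ} {Ω : Type v} [MeasurableSpace Ω]

/-- Whether the score of `x` reaches the level `i / R`. -/
noncomputable def reaches (x : Scored Ω) (i : Fin (R + 2)) : Bool :=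
  decide ((i : ℝ) / R ≤ (x.2 : ℝ))

/-- For each level, how many of the samples reach it. -/
def levelCount (b : Fin N₁ → Fin (R + 2) → Bool) (i : Fin (R + 2)) : Fin (N₁ + 1) :=
  ⟨(Finset.univ.filter fun n => b n i = true).card,
    Nat.lt_succ_of_le ((Finset.card_filter_le _ _).trans (by simp))⟩

/-- Choose a level by `c` from the level counts of the first `N₁` samples, and then the first of the
remaining samples whose coin is heads or whose score reaches this level. -/
def chooseIndex (c : (Fin (R + 2) → Fin (N₁ + 1)) → Fin (R + 1))
    (s : Fin N₁ ⊕ Fin N₂ → Bool × Fin K) (b : Fin (N₁ + N₂) → Fin (R + 2) → Bool) :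
    Option (Fin (N₁ + N₂)) :=
  (Fin.find? fun k : Fin N₂ => (s (Sum.inr k)).1 || b (Fin.natAdd N₁ k)
    (c (levelCount fun n => b (Fin.castAdd N₂ n))).castSucc).elim none
    fun k => cond (s (Sum.inr k)).1 none (some (Fin.natAdd N₁ k))

/-- A trial is accepted at level `r` if its coin is heads or its score reaches `r / R`. -/
noncomputable def accepts (r : Fin (R + 1)) (w : Trial K (Scored Ω)) : Bool :=
  w.1 || reaches w.2.2 r.castSucc

/-- What is output on accepting a trial: `⊥` if its coin is heads. -/
def emit (w : Trial K (Scored Ω)) : Outcome K (Scored Ω) := cond w.1 (Sum.inl ()) (Sum.inr w.2)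

theorem measurable_reaches (i : Fin (R + 2)) :
    Measurable fun x : Scored Ω => reaches x i := by
  refine measurable_to_bool ?_
  have : (fun x : Scored Ω => reaches x i) ⁻¹' {true} = {x | (i : ℝ) / R ≤ (x.2 : ℝ)} := by
    ext x
    simp [reaches]
  rw [this]
  exact measurableSet_le measurable_const (measurable_subtype_coe.comp measurable_snd)

theorem measurable_reaches_pi :
    Measurable fun x : Scored Ω => (reaches x : Fin (R + 2) → Bool) :=
  measurable_pi_lambda _ measurable_reaches

theorem measurable_accepts (r : Fin (R + 1)) :
    Measurable (accepts r : Trial K (Scored Ω) → Bool) := by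
  have h : Measurable fun w : Trial K (Scored Ω) => (w.1, reaches w.2.2 r.castSucc) :=
    measurable_fst.prodMk
      ((measurable_reaches r.castSucc).comp (measurable_snd.comp measurable_snd))
  exact (measurable_of_countable fun b : Bool × Bool => b.1 || b.2).comp h

theorem measurable_emit : Measurable (emit : Trial K (Scored Ω) → Outcome K (Scored Ω)) := by
  have h : (emit : Trial K (Scored Ω) → Outcome K (Scored Ω)) =
      fun w => if w.1 = true then Sum.inl () else Sum.inr w.2 := by
    funext w
    rcases w with ⟨_ | _, w⟩ <;> rfl
  rw [h]
  exact Measurable.ite (measurable_fst (measurableSet_singleton true)) measurable_const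
    (measurable_inr.comp measurable_snd)

/-- The law of the seed: a choice of level for each table of level counts, and one coin and
candidate for each trial. -/
noncomputable def selectionSeedLaw (hK : 0 < K) (N₂ : ℕ)
    {q : (Fin (R + 2) → Fin (N₁ + 1)) → Fin (R + 1) → ℝ}
    (hq : ∀ h r, 0 ≤ q h r) (hq1 : ∀ h, ∑ r, q h r = 1) {γ : ℝ} (h0 : 0 ≤ γ) (h1 : γ ≤ 1) :
    ProbabilityMeasure (((Fin (R + 2) → Fin (N₁ + 1)) → Fin (R + 1)) ×
      (Fin N₁ ⊕ Fin N₂ → Bool × Fin K)) :=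
  ⟨(Measure.pi fun h => finiteLaw (q h)).prod (Measure.pi fun _ => finiteLaw (coinProb K γ)), by
    have := fun h => isProbabilityMeasure_finiteLaw (hq h) (hq1 h)
    have := isProbabilityMeasure_finiteLaw (coinProb_nonneg (K := K) h0 h1) (sum_coinProb hK γ)
    infer_instance⟩

variable (hK : 0 < K) (N₂ : ℕ) {q : (Fin (R + 2) → Fin (N₁ + 1)) → Fin (R + 1) → ℝ}
    (hq : ∀ h r, 0 ≤ q h r) (hq1 : ∀ h, ∑ r, q h r = 1) {γ : ℝ} (h0 : 0 ≤ γ) (h1 : γ ≤ 1)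

/-- Estimate from `N₁` trials how likely the levels are reached, choose one of them with the
probabilities `q`, and release the first of `N₂` further trials that is accepted there. -/
noncomputable def selectionAlgorithm : OracleAlgorithm K (Scored Ω) :=
  OracleAlgorithm.ofFixedCalls hK (N₁ + N₂) _ (selectionSeedLaw hK N₂ hq hq1 h0 h1)
    (fun j s => (s.2 (finSumFinEquiv.symm j)).2)
    (fun j => measurable_snd.comp ((measurable_pi_apply _).comp measurable_snd))
    (fun z => chooseIndex z.1.1 z.1.2 fun j => reaches (z.2 j).2)
    (fun a => by
      have hF : Measurable fun z : ((((Fin (R + 2) → Fin (N₁ + 1)) → Fin (R + 1)) ×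
          (Fin N₁ ⊕ Fin N₂ → Bool × Fin K)) × (Fin (N₁ + N₂) → Fin (R + 2) → Bool)) =>
          (decide (chooseIndex z.1.1 z.1.2 z.2 = a) : Bool) := measurable_of_countable _
      have hg : Measurable fun z : ((((Fin (R + 2) → Fin (N₁ + 1)) → Fin (R + 1)) ×
          (Fin N₁ ⊕ Fin N₂ → Bool × Fin K)) × Transcript K (Scored Ω) (N₁ + N₂)) =>
          (z.1, fun j => (reaches (z.2 j).2 : Fin (R + 2) → Bool)) :=
        measurable_fst.prodMk (measurable_pi_lambda _ fun j =>
          measurable_reaches_pi.comp (measurable_snd.comp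
            ((measurable_pi_apply j).comp measurable_snd)))
      have := (hF.comp hg) (measurableSet_singleton true)
      convert this using 1
      ext z
      simp)

/-- The probability of the level counts `h` in the first stage. -/
noncomputable def countProb (γ : ℝ) (M : Fin K → ProbabilityMeasure (Scored Ω))
    (h : Fin (R + 2) → Fin (N₁ + 1)) : ℝ :=
  (Measure.pi fun _ : Fin N₁ => trialLaw γ M).real
    {y | levelCount (fun n => reaches (y n).2.2) = h}

/-- The probability of the outcomes `S` in the second stage at level `r`. -/
noncomputable def releaseProb (N₂ : ℕ) (γ : ℝ) (M : Fin K → ProbabilityMeasure (Scored Ω))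
    (r : Fin (R + 1)) (S : Set (Outcome K (Scored Ω))) : ℝ :=
  (Measure.pi fun _ : Fin N₂ => trialLaw γ M).real
    (firstAccepted (accepts r) emit (Sum.inl ()) ⁻¹' S)

theorem selectionAlgorithm_outcome (ω : (((Fin (R + 2) → Fin (N₁ + 1)) → Fin (R + 1)) ×
      (Fin N₁ ⊕ Fin N₂ → Bool × Fin K)) × (ℕ → Fin K → Scored Ω)) :
    (selectionAlgorithm hK N₂ hq hq1 h0 h1).outcome ω =
      firstAccepted (N := N₂) (accepts (ω.1.1 (levelCount fun n =>
        reaches (readTrial (ω.1.2 (Sum.inl n), ω.2 (finSumFinEquiv (Sum.inl n : Fin N₁ ⊕ Fin N₂)))).2.2)))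
        emit (Sum.inl ())
        (fun n => readTrial
          (ω.1.2 (Sum.inr n), ω.2 (finSumFinEquiv (Sum.inr n : Fin N₁ ⊕ Fin N₂)))) := by
  refine (OracleAlgorithm.ofFixedCalls_outcome _ _ _ _ _ _ _ _ ω).trans ?_
  simp only [chooseIndex, finSumFinEquiv_symm_apply_natAdd, finSumFinEquiv_symm_apply_castAdd,
    firstAccepted, accepts, readTrial, finSumFinEquiv_apply_left, finSumFinEquiv_apply_right]
  generalize Fin.find? _ = o
  cases o with
  | none => rfl
  | some k =>
    simp only [Option.elim_some, emit]
    cases h : (ω.1.2 (Sum.inr k)).1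
    · simp
    · simp

theorem measurable_levelCount : Measurable fun y : Fin N₁ → Trial K (Scored Ω) =>
    (levelCount (fun n => reaches (y n).2.2) : Fin (R + 2) → Fin (N₁ + 1)) := by
  have hg : Measurable fun y : Fin N₁ → Trial K (Scored Ω) =>
      fun n => (reaches (y n).2.2 : Fin (R + 2) → Bool) :=
    measurable_pi_lambda _ fun j => measurable_reaches_pi.comp
      (measurable_snd.comp (measurable_snd.comp (measurable_pi_apply j)))
  exact (measurable_of_countable (levelCount : (Fin N₁ → Fin (R + 2) → Bool) → _)).comp hg

/-- The seed draws in advance an independent level for every possible table of counts. Only the one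
for the observed table is used, and it has law `q h`, independently of both stages. Splitting over
tables and levels thus gives products of three probabilities. -/
theorem selectionAlgorithm_outputLaw (M : Fin K → ProbabilityMeasure (Scored Ω))
    {S : Set (Outcome K (Scored Ω))} (hS : MeasurableSet S) :
    ((selectionAlgorithm hK N₂ hq hq1 h0 h1).outputLaw M : Measure _).real S =
      ∑ h, countProb γ M h * ∑ r, q h r * releaseProb N₂ γ M r S := by
  have hQ := fun h => isProbabilityMeasure_finiteLaw (hq h) (hq1 h)
  have hσ := isProbabilityMeasure_finiteLaw (coinProb_nonneg (K := K) h0 h1) (sum_coinProb hK γ)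
  have hτ := isProbabilityMeasure_trialLaw hK h0 h1 M
  set e : Fin N₁ ⊕ Fin N₂ → ℕ := fun j => (finSumFinEquiv j : Fin (N₁ + N₂)) with he
  have hinj : Function.Injective e := Fin.val_injective.comp finSumFinEquiv.injective
  have hmp := measurePreserving_trials (Measure.pi fun h => finiteLaw (q h))
    (finiteLaw (coinProb K γ)) (Measure.pi fun i => (M i : Measure (Scored Ω))) hinj
    measurable_readTrial
  set E : Set (((Fin (R + 2) → Fin (N₁ + 1)) → Fin (R + 1)) × (Fin N₁ → Trial K (Scored Ω)) ×
      (Fin N₂ → Trial K (Scored Ω))) :=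
    ⋃ p ∈ (Finset.univ : Finset ((Fin (R + 2) → Fin (N₁ + 1)) × Fin (R + 1))),
      {c | c p.1 = p.2} ×ˢ ({y | levelCount (fun n => reaches (y n).2.2) = p.1} ×ˢ
        (firstAccepted (accepts p.2) emit (Sum.inl ()) ⁻¹' S)) with hE
  have hm1 : ∀ p : (Fin (R + 2) → Fin (N₁ + 1)) × Fin (R + 1),
      MeasurableSet {c : (Fin (R + 2) → Fin (N₁ + 1)) → Fin (R + 1) | c p.1 = p.2} := fun p =>
    measurableSet_eq_fun (measurable_pi_apply p.1) measurable_const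
  have hm2 : ∀ h, MeasurableSet {y : Fin N₁ → Trial K (Scored Ω) |
      (levelCount (fun n => reaches (y n).2.2) : Fin (R + 2) → Fin (N₁ + 1)) = h} := fun h =>
    measurable_levelCount (measurableSet_singleton h)
  have hm3 : ∀ r : Fin (R + 1), MeasurableSet
      (firstAccepted (N := N₂) (accepts r) (emit (K := K) (Ω := Ω)) (Sum.inl ()) ⁻¹' S) := fun r =>
    measurable_firstAccepted (measurable_accepts r) measurable_emit _ hS
  have hmE : MeasurableSet E := Finset.measurableSet_biUnion _ fun p _ =>
    (hm1 p).prod ((hm2 p.1).prod (hm3 p.2))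
  have hpre : (selectionAlgorithm hK N₂ hq hq1 h0 h1).outcome ⁻¹' S =
      (fun ω : (((Fin (R + 2) → Fin (N₁ + 1)) → Fin (R + 1)) ×
        (Fin N₁ ⊕ Fin N₂ → Bool × Fin K)) × (ℕ → Fin K → Scored Ω) =>
        (ω.1.1, (fun j => readTrial (ω.1.2 (Sum.inl j), ω.2 (e (Sum.inl j)))),
          (fun j => readTrial (ω.1.2 (Sum.inr j), ω.2 (e (Sum.inr j)))))) ⁻¹' E := by
    have hmem : ∀ c y w, (c, y, w) ∈ E ↔ firstAccepted
        (accepts (c (levelCount fun n => reaches (y n).2.2))) emit (Sum.inl ()) w ∈ S := by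
      intro c y w
      simp [hE]
    exact Set.ext fun ω => (iff_of_eq (congrArg (· ∈ S)
      (selectionAlgorithm_outcome hK N₂ hq hq1 h0 h1 ω))).trans (hmem _ _ _).symm
  have hlaw : ((selectionAlgorithm hK N₂ hq hq1 h0 h1).outputLaw M : Measure _).real S =
      ((selectionAlgorithm hK N₂ hq hq1 h0 h1).runLaw M : Measure _).real
        ((selectionAlgorithm hK N₂ hq hq1 h0 h1).outcome ⁻¹' S) :=
    map_measureReal_apply (OracleAlgorithm.measurable_outcome _) hS
  rw [hlaw, hpre]
  refine (hmp.measureReal_preimage hmE.nullMeasurableSet).trans ?_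
  rw [hE, measureReal_biUnion_finset, ← Finset.univ_product_univ, Finset.sum_product]
  · refine Finset.sum_congr rfl fun h _ => ?_
    rw [Finset.mul_sum]
    refine Finset.sum_congr rfl fun r _ => ?_
    rw [measureReal_prod_prod, measureReal_prod_prod]
    have : (Measure.pi fun h => finiteLaw (q h)).real {c | c h = r} = q h r := by
      rw [← finiteLaw_real_singleton (hq h) r]
      exact (measurePreserving_eval (fun h => finiteLaw (q h)) h).measureReal_preimage
        (measurableSet_singleton r).nullMeasurableSet
    rw [this, countProb, releaseProb, trialLaw]
    ring
  · rintro ⟨h, r⟩ _ ⟨h', r'⟩ _ hne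
    refine Set.disjoint_left.2 ?_
    rintro ⟨c, y, w⟩ ⟨hc, hy, -⟩ ⟨hc', hy', -⟩
    have e1 : h = h' := Eq.trans (Eq.symm hy) hy'
    subst e1
    have e2 : r = r' := Eq.trans (Eq.symm hc) hc'
    exact hne (Prod.ext rfl e2)
  · exact fun p _ => (hm1 p).prod ((hm2 p.1).prod (hm3 p.2))

end Selection

section Analysis

variable {K R N₁ N₂ : ℕ} {Ω : Type v} [MeasurableSpace Ω]

/-! ### Level probabilities and their estimates -/

/-- The probability that a trial reaches level `i / R`. -/
noncomputable def reachProb (R : ℕ) (γ : ℝ) (M : Fin K → ProbabilityMeasure (Scored Ω))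
    (i : Fin (R + 2)) : ℝ :=
  (trialLaw γ M).real {w | reaches w.2.2 i = true}

/-- The estimate of `reachProb` from the level counts of `N₁` trials. -/
noncomputable def empiricalProb (h : Fin (R + 2) → Fin (N₁ + 1)) (i : Fin (R + 2)) : ℝ :=
  ((h i : ℕ) : ℝ) / N₁

open Classical in
/-- The level counts whose estimates deviate too much from the level probabilities `p`. -/
noncomputable def deviating (N₁ : ℕ) (m η : ℝ) (p : Fin (R + 2) → ℝ) :
    Finset (Fin (R + 2) → Fin (N₁ + 1)) :=
  Finset.univ.filter fun h => ∃ i, η * max m (p i) ≤ |empiricalProb h i - p i|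

theorem measurableSet_reaches (i : Fin (R + 2)) :
    MeasurableSet {w : Trial K (Scored Ω) | reaches w.2.2 i = true} :=
  ((measurable_reaches i).comp (measurable_snd.comp measurable_snd)) (measurableSet_singleton true)

theorem reachProb_zero (hK : 0 < K) {γ : ℝ} (h0 : 0 ≤ γ) (h1 : γ ≤ 1)
    (M : Fin K → ProbabilityMeasure (Scored Ω)) : reachProb R γ M 0 = 1 := by
  have := isProbabilityMeasure_trialLaw hK h0 h1 M
  have h : {w : Trial K (Scored Ω) | reaches w.2.2 (0 : Fin (R + 2)) = true} = Set.univ := by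
    ext w
    simpa [reaches] using w.2.2.2.2.1
  rw [reachProb, h, probReal_univ]

/-- The extra level `(R + 1) / R` lies above all scores; it forces the curve to come down to 0, so
that a crossing always exists. -/
theorem reachProb_last (hR : 0 < R) {γ : ℝ} (M : Fin K → ProbabilityMeasure (Scored Ω)) :
    reachProb R γ M (Fin.last _) = 0 := by
  have h : {w : Trial K (Scored Ω) | reaches w.2.2 (Fin.last (R + 1)) = true} = ∅ := by
    ext w
    have hR' : (0 : ℝ) < R := by positivity
    have h1 : (1 : ℝ) < ((R + 1 : ℕ) : ℝ) / R := by
      rw [lt_div_iff₀ hR']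
      push_cast
      linarith
    have h2 : (w.2.2.2 : ℝ) ≤ 1 := w.2.2.2.2.2
    simp only [reaches, Fin.val_last, Set.mem_ofPred_eq, decide_eq_true_eq, Set.mem_empty_iff_false,
      iff_false, not_le]
    linarith
  rw [reachProb, h, measureReal_empty]

theorem reachProb_eq {γ : ℝ} (h0 : 0 ≤ γ) (h1 : γ ≤ 1)
    (M : Fin K → ProbabilityMeasure (Scored Ω)) (i : Fin (R + 2)) :
    reachProb R γ M i =
      ∑ k, (M k : Measure (Scored Ω)).real {x | (i : ℝ) / R ≤ (x.2 : ℝ)} / K := by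
  rw [reachProb, trialLaw_real h0 h1 M (measurableSet_reaches i), Fintype.sum_prod_type_right]
  refine Finset.sum_congr rfl fun k _ => ?_
  simp only [Fintype.sum_bool, coinProb, reaches, Set.mem_ofPred_eq, decide_eq_true_eq, if_true,
    Bool.false_eq_true, if_false]
  ring

theorem sum_countProb_mem (hK : 0 < K) {γ : ℝ} (h0 : 0 ≤ γ) (h1 : γ ≤ 1)
    (M : Fin K → ProbabilityMeasure (Scored Ω)) (B : Finset (Fin (R + 2) → Fin (N₁ + 1))) :
    ∑ h ∈ B, countProb γ M h = (Measure.pi fun _ : Fin N₁ => trialLaw γ M).real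
      {y | levelCount (fun n => reaches (y n).2.2) ∈ B} := by
  have := isProbabilityMeasure_trialLaw hK h0 h1 M
  exact sum_measureReal_preimage_singleton (μ := Measure.pi fun _ : Fin N₁ => trialLaw γ M) B
    (f := fun y => levelCount (fun n => reaches (y n).2.2))
    fun h _ => measurable_levelCount (measurableSet_singleton h)

theorem countProb_nonneg {γ : ℝ} (M : Fin K → ProbabilityMeasure (Scored Ω))
    (h : Fin (R + 2) → Fin (N₁ + 1)) : 0 ≤ countProb γ M h := measureReal_nonneg

theorem sum_countProb (hK : 0 < K) {γ : ℝ} (h0 : 0 ≤ γ) (h1 : γ ≤ 1)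
    (M : Fin K → ProbabilityMeasure (Scored Ω)) :
    ∑ h : Fin (R + 2) → Fin (N₁ + 1), countProb γ M h = 1 := by
  have := isProbabilityMeasure_trialLaw hK h0 h1 M
  rw [sum_countProb_mem hK h0 h1]
  simp

/-- A union bound over the `R + 2` levels of the Chernoff bound at scale `max m p`, with that scale
weakened to `m` in the exponent. -/
theorem sum_countProb_deviating_le (hK : 0 < K) (hN : 0 < N₁) {γ m η : ℝ} (h0 : 0 ≤ γ)
    (h1 : γ ≤ 1) (hη : 0 < η) (hη1 : η ≤ 1)
    (M : Fin K → ProbabilityMeasure (Scored Ω)) :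
    ∑ h ∈ deviating N₁ m η (reachProb R γ M), countProb γ M h ≤
      (R + 2) * (2 * Real.exp (-(N₁ * m * η ^ 2 / 4))) := by
  classical
  have := isProbabilityMeasure_trialLaw hK h0 h1 M
  have hN' : (0 : ℝ) < N₁ := by positivity
  rw [sum_countProb_mem hK h0 h1]
  set μ := Measure.pi fun _ : Fin N₁ => trialLaw γ M
  obtain ⟨A, hA⟩ : ∃ A : Fin (R + 2) → Set (Trial K (Scored Ω)),
      A = fun i => {w | reaches w.2.2 i = true} := ⟨_, rfl⟩
  have hAm : ∀ i, MeasurableSet (A i) := fun i => hA ▸ measurableSet_reaches i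
  have hAp : ∀ i, reachProb R γ M i = (trialLaw γ M).real (A i) := fun i => by rw [hA]; rfl
  have hsub : {y : Fin N₁ → Trial K (Scored Ω) |
      levelCount (fun n => reaches (y n).2.2) ∈ deviating N₁ m η (reachProb R γ M)} ⊆
      ⋃ i ∈ (Finset.univ : Finset (Fin (R + 2))), {y | N₁ * (η * max m (reachProb R γ M i)) ≤
        |((Finset.univ.filter fun n => y n ∈ A i).card : ℝ) - N₁ * (trialLaw γ M).real (A i)|} := by
    intro y hy
    have hy' := Set.mem_ofPred.1 hy
    rw [deviating, Finset.mem_filter] at hy'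
    obtain ⟨-, i, hi⟩ := hy'
    simp only [Set.mem_iUnion]
    refine ⟨i, Finset.mem_univ _, ?_⟩
    rw [Set.mem_ofPred_eq]
    have hcard : ((Finset.univ.filter fun n => y n ∈ A i).card : ℝ) =
        N₁ * empiricalProb (levelCount (fun n => reaches (y n).2.2)) i := by
      rw [empiricalProb, mul_div_cancel₀ _ hN'.ne']
      simp [levelCount, hA]
    rw [hcard, ← hAp, ← mul_sub, abs_mul, abs_of_pos hN']
    exact mul_le_mul_of_nonneg_left hi hN'.le
  calc _ ≤ _ := measureReal_mono hsub (measure_ne_top _ _)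
    _ ≤ ∑ i ∈ (Finset.univ : Finset (Fin (R + 2))), _ := measureReal_biUnion_finset_le _ _
    _ ≤ ∑ i ∈ (Finset.univ : Finset (Fin (R + 2))), 2 * Real.exp (-(N₁ * m * η ^ 2 / 4)) := by
        refine Finset.sum_le_sum fun i _ => ?_
        refine (measureReal_abs_count_deviation_le (N := N₁) (A := A i) (trialLaw γ M)
          (hAm i) hη hη1 ((hAp i).symm.le.trans (le_max_right m _))).trans ?_
        have : m ≤ max m (reachProb R γ M i) := le_max_left _ _
        gcongr
    _ = _ := by simp

theorem abs_sub_lt_of_notMem_deviating {m η : ℝ} {p : Fin (R + 2) → ℝ}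
    {h : Fin (R + 2) → Fin (N₁ + 1)} (hh : h ∉ deviating N₁ m η p) (i : Fin (R + 2)) :
    |empiricalProb h i - p i| < η * max m (p i) := by
  classical
  simp only [deviating, Finset.mem_filter, Finset.mem_univ, true_and, not_exists, not_le] at hh
  exact hh i

theorem one_add_le_exp_two_mul {η : ℝ} (h : 0 ≤ η) : 1 + η ≤ Real.exp (2 * η) := by
  linarith [Real.add_one_le_exp (2 * η)]

theorem one_le_exp_two_mul_mul {η : ℝ} (h : 0 ≤ η) (h1 : η ≤ 1 / 2) :
    1 ≤ Real.exp (2 * η) * (1 - η) := by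
  nlinarith [Real.add_one_le_exp (2 * η)]

/-- After clipping at `m`, an additive error of η `max m p` is a multiplicative one even where `p`
is far below `m`. -/
theorem max_empirical_le {m η p e : ℝ} (hm : 0 < m) (hη : 0 ≤ η)
    (h : |e - p| < η * max m p) : max m e ≤ Real.exp (2 * η) * max m p := by
  have hv : 0 < max m p := lt_max_of_lt_left hm
  have h1 : max m e ≤ (1 + η) * max m p := by
    refine max_le ?_ ?_
    · nlinarith [le_max_left m p]
    · nlinarith [le_max_right m p, (abs_lt.1 h).2]
  exact h1.trans (mul_le_mul_of_nonneg_right (one_add_le_exp_two_mul hη) hv.le)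

theorem max_le_empirical {m η p e : ℝ} (hm : 0 < m) (hη : 0 ≤ η) (hη1 : η ≤ 1 / 2)
    (h : |e - p| < η * max m p) : max m p ≤ Real.exp (2 * η) * max m e := by
  have hv : 0 < max m p := lt_max_of_lt_left hm
  have h1 : (1 - η) * max m p ≤ max m e := by
    rcases le_total p m with hp | hp
    · rw [max_eq_left hp]
      exact le_max_of_le_left (by nlinarith)
    · rw [max_eq_right hp] at h ⊢
      exact le_max_of_le_right (by linarith [(abs_lt.1 h).1])
  calc max m p = 1 * max m p := (one_mul _).symm
    _ ≤ Real.exp (2 * η) * (1 - η) * max m p :=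
        mul_le_mul_of_nonneg_right (one_le_exp_two_mul_mul hη hη1) hv.le
    _ = Real.exp (2 * η) * ((1 - η) * max m p) := by ring
    _ ≤ _ := mul_le_mul_of_nonneg_left h1 (Real.exp_pos _).le

/-! ### The second stage -/

open Classical in
theorem releaseProb_eq (hK : 0 < K) {γ : ℝ} (h0 : 0 ≤ γ) (h1 : γ ≤ 1)
    (M : Fin K → ProbabilityMeasure (Scored Ω)) (r : Fin (R + 1)) {S : Set (Outcome K (Scored Ω))}
    (hS : MeasurableSet S) :
    releaseProb N₂ γ M r S =
      (∑ j ∈ Finset.range N₂, (1 - (trialLaw γ M).real {w | accepts r w = true}) ^ j) *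
        (trialLaw γ M).real {w | accepts r w = true ∧ emit w ∈ S} +
      (1 - (trialLaw γ M).real {w | accepts r w = true}) ^ N₂ *
        (if (Sum.inl () : Outcome K (Scored Ω)) ∈ S then 1 else 0) := by
  have := isProbabilityMeasure_trialLaw hK h0 h1 M
  exact measureReal_firstAccepted _ (measurable_accepts r) measurable_emit _ hS

theorem releaseProb_nonneg {γ : ℝ} (M : Fin K → ProbabilityMeasure (Scored Ω)) (r : Fin (R + 1))
    (S : Set (Outcome K (Scored Ω))) : 0 ≤ releaseProb N₂ γ M r S := measureReal_nonneg

theorem releaseProb_le_one (hK : 0 < K) {γ : ℝ} (h0 : 0 ≤ γ) (h1 : γ ≤ 1)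
    (M : Fin K → ProbabilityMeasure (Scored Ω)) (r : Fin (R + 1))
    (S : Set (Outcome K (Scored Ω))) : releaseProb N₂ γ M r S ≤ 1 := by
  have := isProbabilityMeasure_trialLaw hK h0 h1 M
  exact measureReal_le_one

theorem trialLaw_real_heads (hK : 0 < K) {γ : ℝ} (h0 : 0 ≤ γ) (h1 : γ ≤ 1)
    (M : Fin K → ProbabilityMeasure (Scored Ω)) :
    (trialLaw γ M).real {w | w.1 = true} = γ := by
  have hm : MeasurableSet {w : Trial K (Scored Ω) | w.1 = true} :=
    measurable_fst (measurableSet_singleton true)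
  rw [trialLaw_real h0 h1 M hm, Fintype.sum_prod_type]
  have : (K : ℝ) ≠ 0 := by positivity
  simp [coinProb]
  field_simp

theorem measurableSet_accepts (r : Fin (R + 1)) :
    MeasurableSet {w : Trial K (Scored Ω) | accepts r w = true} :=
  measurable_accepts r (measurableSet_singleton true)

theorem le_trialLaw_real_accepts (hK : 0 < K) {γ : ℝ} (h0 : 0 ≤ γ) (h1 : γ ≤ 1)
    (M : Fin K → ProbabilityMeasure (Scored Ω)) (r : Fin (R + 1)) :
    γ ≤ (trialLaw γ M).real {w | accepts r w = true} := by
  have := isProbabilityMeasure_trialLaw hK h0 h1 M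
  conv_lhs => rw [← trialLaw_real_heads hK h0 h1 M]
  refine measureReal_mono fun w hw => ?_
  have : w.1 = true := hw
  simp [accepts, this]

theorem reachProb_le_trialLaw_real_accepts (hK : 0 < K) {γ : ℝ} (h0 : 0 ≤ γ) (h1 : γ ≤ 1)
    (M : Fin K → ProbabilityMeasure (Scored Ω)) (r : Fin (R + 1)) :
    reachProb R γ M r.castSucc ≤ (trialLaw γ M).real {w | accepts r w = true} := by
  have := isProbabilityMeasure_trialLaw hK h0 h1 M
  refine measureReal_mono fun w hw => ?_
  have : reaches w.2.2 r.castSucc = true := hw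
  simp [accepts, this]

/-- One factor e^ε comes from the geometric sum of rejections, the other from the accepted trial
itself. The event that nothing is accepted has no such comparison and becomes the additive term; the
coin bounds it by `(1 - γ) ^ N₂` at every level. -/
theorem releaseProb_le (hK : 0 < K) {γ ε : ℝ} (h0 : 0 < γ) (h1 : γ ≤ 1) (hε : 0 ≤ ε)
    {M M' : Fin K → ProbabilityMeasure (Scored Ω)}
    (h : ∀ i, ∀ S, MeasurableSet S → (M i : Measure (Scored Ω)).real S ≤
      Real.exp ε * (M' i : Measure (Scored Ω)).real S)
    (h' : ∀ i, ∀ S, MeasurableSet S → (M' i : Measure (Scored Ω)).real S ≤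
      Real.exp ε * (M i : Measure (Scored Ω)).real S)
    (r : Fin (R + 1)) {S : Set (Outcome K (Scored Ω))} (hS : MeasurableSet S) :
    releaseProb N₂ γ M r S ≤
      Real.exp (2 * ε) * releaseProb N₂ γ M' r S + (1 - γ) ^ N₂ := by
  classical
  have hp := isProbabilityMeasure_trialLaw hK h0.le h1 M
  have hp' := isProbabilityMeasure_trialLaw hK h0.le h1 M'
  rw [releaseProb_eq hK h0.le h1 M r hS, releaseProb_eq hK h0.le h1 M' r hS]
  set a := (trialLaw γ M).real {w | accepts r w = true}
  set a' := (trialLaw γ M').real {w | accepts r w = true}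
  have ha : γ ≤ a := le_trialLaw_real_accepts hK h0.le h1 M r
  have ha' : γ ≤ a' := le_trialLaw_real_accepts hK h0.le h1 M' r
  have ha1 : a ≤ 1 := measureReal_le_one
  have ha1' : a' ≤ 1 := measureReal_le_one
  have hle' : a' ≤ Real.exp ε * a := trialLaw_real_le h0.le h1 h' (measurableSet_accepts r)
  have hg := geomSum_le_exp_mul N₂ ha1 (h0.trans_le ha') ha1' hε hle'
  have hS' : (trialLaw γ M).real {w | accepts r w = true ∧ emit w ∈ S} ≤
      Real.exp ε * (trialLaw γ M').real {w | accepts r w = true ∧ emit w ∈ S} :=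
    trialLaw_real_le h0.le h1 h (measurableSet_acc_and (measurable_accepts r) measurable_emit hS)
  have hn' : 0 ≤ ∑ j ∈ Finset.range N₂, (1 - a') ^ j :=
    Finset.sum_nonneg fun j _ => pow_nonneg (by linarith) _
  have hpow : (1 - a) ^ N₂ * (if (Sum.inl () : Outcome K (Scored Ω)) ∈ S then 1 else 0) ≤
      (1 - γ) ^ N₂ := by
    have h2 : (1 - a) ^ N₂ ≤ (1 - γ) ^ N₂ := pow_le_pow_left₀ (by linarith) (by linarith) _
    have h3 : 0 ≤ (1 - γ) ^ N₂ := pow_nonneg (by linarith) _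
    split_ifs
    · linarith
    · linarith
  have hpow' : 0 ≤ (1 - a') ^ N₂ *
      (if (Sum.inl () : Outcome K (Scored Ω)) ∈ S then (1 : ℝ) else 0) :=
    mul_nonneg (pow_nonneg (by linarith) _) (by split_ifs <;> norm_num)
  refine add_le_add ?_ hpow
  calc _ ≤ (Real.exp ε * ∑ j ∈ Finset.range N₂, (1 - a') ^ j) *
        (Real.exp ε * (trialLaw γ M').real {w | accepts r w = true ∧ emit w ∈ S}) :=
        mul_le_mul hg hS' measureReal_nonneg (mul_nonneg (Real.exp_pos _).le hn')
    _ = Real.exp (2 * ε) * ((∑ j ∈ Finset.range N₂, (1 - a') ^ j) *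
        (trialLaw γ M').real {w | accepts r w = true ∧ emit w ∈ S}) := by
        rw [two_mul, Real.exp_add]
        ring
    _ ≤ _ := mul_le_mul_of_nonneg_left (le_add_of_nonneg_right hpow') (Real.exp_pos _).le

theorem measurableSet_bot_outcome : MeasurableSet {(Sum.inl () : Outcome K (Scored Ω))} := by
  have : ({Sum.inl ()} : Set (Outcome K (Scored Ω))) = Set.range Sum.inl := by
    ext x
    rcases x with ⟨⟩ | x <;> simp
  rw [this]
  exact measurableSet_range_inl

/-- Conditionally on acceptance the coin is heads with probability γ / a, where the acceptance
probability a is at least `reachProb`; the other way to get ⊥ is that all trials are rejected. -/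
theorem releaseProb_bot_le (hK : 0 < K) {γ : ℝ} (h0 : 0 < γ) (h1 : γ ≤ 1)
    (M : Fin K → ProbabilityMeasure (Scored Ω)) (r : Fin (R + 1))
    (hr : 0 < reachProb R γ M r.castSucc) :
    releaseProb N₂ γ M r {Sum.inl ()} ≤ γ / reachProb R γ M r.castSucc + (1 - γ) ^ N₂ := by
  classical
  have hp := isProbabilityMeasure_trialLaw hK h0.le h1 M
  rw [releaseProb_eq hK h0.le h1 M r measurableSet_bot_outcome]
  have ha := le_trialLaw_real_accepts hK h0.le h1 M r
  have hra := reachProb_le_trialLaw_real_accepts hK h0.le h1 M r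
  set a := (trialLaw γ M).real {w | accepts r w = true}
  have ha1 : a ≤ 1 := measureReal_le_one
  have ha0 : 0 < a := h0.trans_le ha
  have hset : {w : Trial K (Scored Ω) | accepts r w = true ∧ emit w ∈
      ({Sum.inl ()} : Set (Outcome K (Scored Ω)))} = {w | w.1 = true} := by
    ext ⟨b, w⟩
    cases b <;> simp [accepts, emit]
  rw [hset, trialLaw_real_heads hK h0.le h1 M]
  have hgs : a * ∑ j ∈ Finset.range N₂, (1 - a) ^ j = 1 - (1 - a) ^ N₂ := by
    simpa using mul_neg_geom_sum (1 - a) N₂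
  have hpn : 0 ≤ (1 - a) ^ N₂ := pow_nonneg (by linarith) _
  refine add_le_add ?_ ?_
  · calc (∑ j ∈ Finset.range N₂, (1 - a) ^ j) * γ ≤ (1 / a) * γ := by
          refine mul_le_mul_of_nonneg_right ?_ h0.le
          rw [le_div_iff₀ ha0, mul_comm]
          linarith
      _ = γ / a := by ring
      _ ≤ _ := by gcongr
  · simp only [Set.mem_singleton_iff, if_true, mul_one]
    exact pow_le_pow_left₀ (by linarith) (by linarith) _

theorem measurableSet_low (K : ℕ) (t : ℝ) :
    MeasurableSet {o : Outcome K (Scored Ω) | ∃ (i : Fin K) (z : Scored Ω),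
      o = Sum.inr (i, z) ∧ (z.2 : ℝ) < t} := by
  have h : MeasurableSet {p : Fin K × Scored Ω | (p.2.2 : ℝ) < t} :=
    measurableSet_lt (measurable_subtype_coe.comp (measurable_snd.comp measurable_snd))
      measurable_const
  have h2 : {o : Outcome K (Scored Ω) | ∃ (i : Fin K) (z : Scored Ω),
      o = Sum.inr (i, z) ∧ (z.2 : ℝ) < t} = Sum.inr '' {p : Fin K × Scored Ω | (p.2.2 : ℝ) < t} := by
    ext o
    constructor
    · rintro ⟨i, z, rfl, hz⟩
      exact ⟨(i, z), hz, rfl⟩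
    · rintro ⟨⟨i, z⟩, hz, rfl⟩
      exact ⟨i, z, rfl, hz⟩
  rw [h2]
  exact h.inr_image

theorem releaseProb_low (hK : 0 < K) {γ t : ℝ} (h0 : 0 ≤ γ) (h1 : γ ≤ 1)
    (M : Fin K → ProbabilityMeasure (Scored Ω)) (r : Fin (R + 1)) (ht : t ≤ (r : ℝ) / R) :
    releaseProb N₂ γ M r {o | ∃ (i : Fin K) (z : Scored Ω),
      o = Sum.inr (i, z) ∧ (z.2 : ℝ) < t} = 0 := by
  classical
  rw [releaseProb_eq hK h0 h1 M r (measurableSet_low K t)]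
  have hset : {w : Trial K (Scored Ω) | accepts r w = true ∧ emit w ∈
      {o : Outcome K (Scored Ω) | ∃ (i : Fin K) (z : Scored Ω),
        o = Sum.inr (i, z) ∧ (z.2 : ℝ) < t}} = ∅ := by
    ext ⟨b, k, x⟩
    cases b
    · simp only [accepts, reaches, emit, Set.mem_ofPred_eq, Bool.false_or, decide_eq_true_eq,
        cond_false, Set.mem_empty_iff_false, iff_false, not_and, Fin.val_castSucc]
      rintro h ⟨i, z, hz, hlt⟩
      obtain ⟨-, rfl⟩ := Prod.mk.inj (Sum.inr.inj hz)
      linarith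
    · simp [emit]
  rw [hset]
  simp

end Analysis

section Guarantees

variable {K R N₁ N₂ : ℕ} {Ω : Type v} [MeasurableSpace Ω]

/-! ### Privacy -/

theorem max_reachProb_le {γ ε m : ℝ} (h0 : 0 ≤ γ) (h1 : γ ≤ 1) (hε : 0 ≤ ε) (hm : 0 < m)
    {M M' : Fin K → ProbabilityMeasure (Scored Ω)}
    (h : ∀ i, ∀ S, MeasurableSet S → (M i : Measure (Scored Ω)).real S ≤
      Real.exp ε * (M' i : Measure (Scored Ω)).real S) (i : Fin (R + 2)) :
    max m (reachProb R γ M i) ≤ Real.exp ε * max m (reachProb R γ M' i) := by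
  rw [mul_max_of_nonneg _ _ (Real.exp_pos _).le]
  exact max_le_max (le_mul_of_one_le_left hm.le (Real.one_le_exp hε))
    (trialLaw_real_le h0 h1 h (measurableSet_reaches i))

/-- A chain of comparisons: the estimated curve on D, the true curve on D, the true curve on D', the
estimated curve on D'. The exponents are 4sη, 2sε₁ and 4sη, which add up to ε₀; the second stage
adds 2ε₁. -/
theorem selection_privacy (hK : 0 < K) {γ ε₁ ε₀ m b s η δ₁ δ₂ : ℝ} (h0 : 0 < γ) (h1 : γ ≤ 1)
    (hε₁ : 0 ≤ ε₁) (hε₀ : ε₀ ≤ 1) (hm : 0 < m) (hb : 0 < b) (hs : 0 ≤ s) (hη : 0 ≤ η)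
    (hη1 : η ≤ 1 / 2) (hsη : 2 * s * (ε₁ + 4 * η) = ε₀)
    {M M' : Fin K → ProbabilityMeasure (Scored Ω)}
    (h : ∀ i, ∀ S, MeasurableSet S → (M i : Measure (Scored Ω)).real S ≤
      Real.exp ε₁ * (M' i : Measure (Scored Ω)).real S)
    (h' : ∀ i, ∀ S, MeasurableSet S → (M' i : Measure (Scored Ω)).real S ≤
      Real.exp ε₁ * (M i : Measure (Scored Ω)).real S)
    (hd : ∑ k ∈ deviating N₁ m η (reachProb R γ M), countProb γ M k ≤ δ₁)
    (hd' : ∑ k ∈ deviating N₁ m η (reachProb R γ M'), countProb γ M' k ≤ δ₁)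
    (hδ₂ : (1 - γ) ^ N₂ ≤ δ₂)
    {S : Set (Outcome K (Scored Ω))} (hS : MeasurableSet S) :
    ∑ k : Fin (R + 2) → Fin (N₁ + 1), countProb γ M k *
        ∑ r, levelProb m b s (empiricalProb k) r * releaseProb N₂ γ M r S ≤
      Real.exp (2 * ε₁ + ε₀) * (∑ k : Fin (R + 2) → Fin (N₁ + 1), countProb γ M' k *
        ∑ r, levelProb m b s (empiricalProb k) r * releaseProb N₂ γ M' r S) +
      (4 * δ₁ + δ₂) := by
  classical
  set q : (Fin (R + 2) → Fin (N₁ + 1)) → Fin (R + 1) → ℝ :=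
    fun k => levelProb m b s (empiricalProb k)
  set q₀ := levelProb m b s (reachProb R γ M)
  set q₀' := levelProb m b s (reachProb R γ M')
  -- Capping at 1 is what makes the deviating tables cost `δ₁` rather than e^{2ε₁} `δ₁`; with `δ₂`
  -- added, it still dominates the release probability under `M`.
  set f : Fin (R + 1) → ℝ := fun r => min 1 (Real.exp (2 * ε₁) * releaseProb N₂ γ M' r S)
  have hq : ∀ k r, 0 ≤ q k r := fun k r => levelProb_nonneg hm hb r
  have hq1 : ∀ k, ∑ r, q k r = 1 := fun k => sum_levelProb hm hb
  have hq₀ : ∀ r, 0 ≤ q₀ r := fun r => levelProb_nonneg hm hb r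
  have hq₀' : ∀ r, 0 ≤ q₀' r := fun r => levelProb_nonneg hm hb r
  have hf0 : ∀ r, 0 ≤ f r := fun r => le_min zero_le_one
    (mul_nonneg (Real.exp_pos _).le (releaseProb_nonneg M' r S))
  have hf1 : ∀ r, f r ≤ 1 := fun r => min_le_left _ _
  have hπ : ∀ k : Fin (R + 2) → Fin (N₁ + 1), 0 ≤ countProb γ M k := countProb_nonneg M
  have hπ' : ∀ k : Fin (R + 2) → Fin (N₁ + 1), 0 ≤ countProb γ M' k := countProb_nonneg M'
  have hδ₁ : 0 ≤ δ₁ := (Finset.sum_nonneg fun k _ => hπ k).trans hd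
  have hδ₂0 : 0 ≤ δ₂ := (pow_nonneg (by linarith) _).trans hδ₂
  have hκ : ∀ r, releaseProb N₂ γ M r S ≤ f r + δ₂ := by
    intro r
    rw [← min_add_add_right]
    refine le_min ?_ ((releaseProb_le hK h0 h1 hε₁ h h' r hS).trans (by gcongr))
    linarith [releaseProb_le_one (N₂ := N₂) hK h0.le h1 M r S]
  have hstep1 : ∑ k, countProb γ M k * ∑ r, q k r * releaseProb N₂ γ M r S ≤
      ∑ k, countProb γ M k * ∑ r, q k r * f r + δ₂ := by
    calc _ ≤ ∑ k, countProb γ M k * (∑ r, q k r * f r + δ₂) := by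
          refine Finset.sum_le_sum fun k _ => mul_le_mul_of_nonneg_left ?_ (hπ k)
          calc ∑ r, q k r * releaseProb N₂ γ M r S ≤ ∑ r, q k r * (f r + δ₂) :=
                Finset.sum_le_sum fun r _ => mul_le_mul_of_nonneg_left (hκ r) (hq k r)
            _ = _ := by
                simp only [mul_add, Finset.sum_add_distrib]
                rw [← Finset.sum_mul, hq1, one_mul]
      _ = _ := by
          simp only [mul_add, Finset.sum_add_distrib]
          rw [← Finset.sum_mul, sum_countProb hK h0.le h1, one_mul]
  have hc := Real.exp_pos (2 * s * (2 * η))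
  have hstep2 : ∑ k, countProb γ M k * ∑ r, q k r * f r ≤
      Real.exp (2 * s * (2 * η)) * ∑ r, q₀ r * f r + δ₁ := by
    refine sum_mul_mixture_le hπ (sum_countProb hK h0.le h1 M) hd hq hq1 hq₀ hc.le ?_ hf0 hf1
    intro k hk r
    have hdev := abs_sub_lt_of_notMem_deviating hk
    exact levelProb_le hm hb hs (fun i => max_empirical_le hm hη (hdev i))
      (fun i => max_le_empirical hm hη hη1 (hdev i)) r
  have hstep3 : ∑ r, q₀ r * f r ≤ Real.exp (2 * s * ε₁) * ∑ r, q₀' r * f r := by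
    rw [Finset.mul_sum]
    refine Finset.sum_le_sum fun r _ => ?_
    rw [← mul_assoc]
    exact mul_le_mul_of_nonneg_right (levelProb_le hm hb hs
      (max_reachProb_le h0.le h1 hε₁ hm h) (max_reachProb_le h0.le h1 hε₁ hm h') r) (hf0 r)
  have hstep4 : ∑ r, q₀' r * f r ≤
      Real.exp (2 * s * (2 * η)) * (∑ k, countProb γ M' k * ∑ r, q k r * f r) + δ₁ := by
    refine le_sum_mul_mixture hπ' (sum_countProb hK h0.le h1 M') hd' hq hq₀'
      (sum_levelProb hm hb) hc.le ?_ hf0 hf1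
    intro k hk r
    have hdev := abs_sub_lt_of_notMem_deviating hk
    exact levelProb_le hm hb hs (fun i => max_le_empirical hm hη hη1 (hdev i))
      (fun i => max_empirical_le hm hη (hdev i)) r
  have hstep5 : ∑ k, countProb γ M' k * ∑ r, q k r * f r ≤ Real.exp (2 * ε₁) *
      ∑ k, countProb γ M' k * ∑ r, q k r * releaseProb N₂ γ M' r S := by
    rw [Finset.mul_sum]
    refine Finset.sum_le_sum fun k _ => ?_
    rw [mul_left_comm]
    refine mul_le_mul_of_nonneg_left ?_ (hπ' k)
    rw [Finset.mul_sum]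
    refine Finset.sum_le_sum fun r _ => ?_
    rw [mul_left_comm]
    exact mul_le_mul_of_nonneg_left (min_le_right _ _) (hq k r)
  set T := ∑ k, countProb γ M' k * ∑ r, q k r * f r
  have he1 := Real.exp_pos (2 * s * ε₁)
  have hee : Real.exp (2 * s * (2 * η)) * Real.exp (2 * s * ε₁) * Real.exp (2 * s * (2 * η)) =
      Real.exp ε₀ := by
    rw [← Real.exp_add, ← Real.exp_add, ← hsη]
    congr 1
    ring
  -- This factor multiplies the `δ₁` of the second exchange of tables; with the `δ₁` of the first
  -- one the total is 4 `δ₁`.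
  have hee' : Real.exp (2 * s * (2 * η)) * Real.exp (2 * s * ε₁) ≤ 3 := by
    calc _ = Real.exp (2 * s * (2 * η) + 2 * s * ε₁) := (Real.exp_add _ _).symm
      _ ≤ Real.exp 1 := by
          refine Real.exp_le_exp.2 ?_
          nlinarith [mul_nonneg hs hη]
      _ ≤ 3 := by linarith [Real.exp_one_lt_d9]
  calc _ ≤ ∑ k, countProb γ M k * ∑ r, q k r * f r + δ₂ := hstep1
    _ ≤ (Real.exp (2 * s * (2 * η)) * (Real.exp (2 * s * ε₁) *
        (Real.exp (2 * s * (2 * η)) * T + δ₁)) + δ₁) + δ₂ := by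
        refine add_le_add_left (hstep2.trans (add_le_add_left ?_ _)) _
        exact mul_le_mul_of_nonneg_left (hstep3.trans
          (mul_le_mul_of_nonneg_left hstep4 he1.le)) hc.le
    _ = (Real.exp (2 * s * (2 * η)) * Real.exp (2 * s * ε₁) * Real.exp (2 * s * (2 * η))) * T +
        (Real.exp (2 * s * (2 * η)) * Real.exp (2 * s * ε₁)) * δ₁ + δ₁ + δ₂ := by ring
    _ ≤ Real.exp ε₀ * (Real.exp (2 * ε₁) *
        ∑ k, countProb γ M' k * ∑ r, q k r * releaseProb N₂ γ M' r S) + 3 * δ₁ + δ₁ + δ₂ := by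
        rw [hee]
        gcongr
    _ = _ := by
        rw [Real.exp_add]
        ring

/-! ### Utility -/

/-- The failure has three sources: a bad level is chosen (`α`), the second stage fails at a good
level (`t`), or the estimate deviates (`δ₁`). Both utility claims are instances, with different `f`
and `t`. -/
theorem selection_utility (hK : 0 < K) (hR : 0 < R) {γ m b s η x α δ₁ t : ℝ} (h0 : 0 ≤ γ)
    (h1 : γ ≤ 1)
    (hb : 0 < b) (hb1 : b ≤ 1 / 2) (hs : 0 ≤ s) (hη1 : η ≤ 1 / 2)
    (hx : 0 < x) (hx1 : x ≤ 1) (hm : m = b * x ^ 2) (hα : 0 < α) (hxs : x ^ s = α / (R + 1))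
    (M : Fin K → ProbabilityMeasure (Scored Ω))
    (hd : ∑ k ∈ deviating N₁ m η (reachProb R γ M), countProb γ M k ≤ δ₁)
    {f : Fin (R + 1) → ℝ} (ht : 0 ≤ t) (hf1 : ∀ r, f r ≤ 1)
    (hf : ∀ r, m / 2 < reachProb R γ M r.castSucc → reachProb R γ M r.succ < 2 * b → f r ≤ t) :
    ∑ k, countProb γ M k * ∑ r, levelProb m b s (empiricalProb (N₁ := N₁) k) r * f r ≤
      α + t + δ₁ := by
  classical
  set p := reachProb R γ M
  have hm0 : 0 < m := by rw [hm]; positivity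
  have hmb : m ≤ b := by
    rw [hm]
    exact mul_le_of_le_one_right hb.le (pow_le_one₀ hx.le hx1)
  have hp0 : p 0 = 1 := reachProb_zero hK h0 h1 M
  have hpl : p (Fin.last _) = 0 := reachProb_last hR M
  have hq : ∀ (k : Fin (R + 2) → Fin (N₁ + 1)) r, 0 ≤ levelProb m b s (empiricalProb k) r :=
    fun k r => levelProb_nonneg hm0 hb r
  have hq1 : ∀ k : Fin (R + 2) → Fin (N₁ + 1), ∑ r, levelProb m b s (empiricalProb k) r = 1 :=
    fun k => sum_levelProb hm0 hb
  have hπ : ∀ k : Fin (R + 2) → Fin (N₁ + 1), 0 ≤ countProb γ M k := countProb_nonneg M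
  -- The factors 1/2 and 2 leave room for the relative error η ≤ 1/2: at these levels the estimates
  -- satisfy the hypothesis of `sum_levelProb_le` with `m` and `b` themselves.
  set B : Finset (Fin (R + 1)) :=
    Finset.univ.filter fun r => p r.castSucc ≤ m / 2 ∨ 2 * b ≤ p r.succ with hB
  have hgood : ∀ k ∉ deviating N₁ m η p,
      ∑ r, levelProb m b s (empiricalProb k) r * f r ≤ α + t := by
    intro k hk
    have hdev := abs_sub_lt_of_notMem_deviating hk
    have hbad : ∑ r ∈ B, levelProb m b s (empiricalProb k) r ≤ α := by
      refine sum_levelProb_le hb hs hx hx1 hm hα hxs ?_ ?_ B ?_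
      · have := hdev 0
        rw [hp0, max_eq_right (by linarith)] at this
        linarith [(abs_lt.1 this).1]
      · have := hdev (Fin.last _)
        rw [hpl, max_eq_left hm0.le] at this
        nlinarith [(abs_lt.1 this).2]
      · intro r hr
        rw [hB, Finset.mem_filter] at hr
        rcases hr.2 with h | h
        · left
          have := hdev r.castSucc
          rw [max_eq_left (by linarith)] at this
          nlinarith [(abs_lt.1 this).2]
        · right
          have := hdev r.succ
          rw [max_eq_right (by linarith)] at this
          nlinarith [(abs_lt.1 this).1]
    rw [← Finset.sum_add_sum_compl B]
    refine add_le_add (le_trans (Finset.sum_le_sum fun r _ =>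
      mul_le_of_le_one_right (hq k r) (hf1 r)) hbad) ?_
    calc ∑ r ∈ Bᶜ, levelProb m b s (empiricalProb k) r * f r
        ≤ ∑ r ∈ Bᶜ, levelProb m b s (empiricalProb k) r * t := by
          refine Finset.sum_le_sum fun r hr => mul_le_mul_of_nonneg_left ?_ (hq k r)
          rw [Finset.mem_compl, hB, Finset.mem_filter, not_and] at hr
          have := hr (Finset.mem_univ r)
          push Not at this
          exact hf r this.1 this.2
      _ = (∑ r ∈ Bᶜ, levelProb m b s (empiricalProb k) r) * t := by rw [Finset.sum_mul]
      _ ≤ 1 * t := by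
          refine mul_le_mul_of_nonneg_right ?_ ht
          rw [← hq1 k]
          exact Finset.sum_le_univ_sum_of_nonneg (hq k)
      _ = t := one_mul t
  have hαt : 0 ≤ α + t := by linarith
  rw [← Finset.sum_compl_add_sum (deviating N₁ m η p)]
  refine add_le_add ?_ (le_trans (Finset.sum_le_sum fun k _ => ?_) hd)
  · calc _ ≤ ∑ k ∈ (deviating N₁ m η p)ᶜ, countProb γ M k * (α + t) :=
          Finset.sum_le_sum fun k hk =>
            mul_le_mul_of_nonneg_left (hgood k (Finset.mem_compl.1 hk)) (hπ k)
      _ = (∑ k ∈ (deviating N₁ m η p)ᶜ, countProb γ M k) * (α + t) := by rw [Finset.sum_mul]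
      _ ≤ 1 * (α + t) := by
          refine mul_le_mul_of_nonneg_right ?_ hαt
          rw [← sum_countProb hK h0 h1 M]
          exact Finset.sum_le_univ_sum_of_nonneg hπ
      _ = _ := one_mul _
  · refine mul_le_of_le_one_right (hπ k) ?_
    rw [← hq1 k]
    exact Finset.sum_le_sum fun r _ => mul_le_of_le_one_right (hq k r) (hf1 r)

/-! ### Medians -/

theorem reachProb_antitone (hK : 0 < K) {γ : ℝ} (h0 : 0 ≤ γ) (h1 : γ ≤ 1)
    (M : Fin K → ProbabilityMeasure (Scored Ω)) : Antitone (reachProb R γ M) := by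
  have := isProbabilityMeasure_trialLaw hK h0 h1 M
  intro i j hij
  refine measureReal_mono fun w hw => ?_
  simp only [reaches, Set.mem_ofPred_eq, decide_eq_true_eq] at hw ⊢
  refine le_trans ?_ hw
  have : ((i : ℕ) : ℝ) ≤ ((j : ℕ) : ℝ) := by exact_mod_cast hij
  gcongr

theorem medianScore_le_one (μ : ProbabilityMeasure (Scored Ω)) : medianScore μ ≤ 1 := by
  refine Real.sSup_le (fun τ hτ => ?_) zero_le_one
  by_contra! hlt
  have : {z : Scored Ω | τ ≤ (z.2 : ℝ)} = ∅ := by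
    ext z
    have := z.2.2.2
    simp only [Set.mem_ofPred_eq, Set.mem_empty_iff_false, iff_false, not_le]
    linarith
  rw [Set.mem_ofPred_eq, this, measureReal_empty] at hτ
  norm_num at hτ

theorem half_le_of_lt_medianScore {μ : ProbabilityMeasure (Scored Ω)} {τ : ℝ} (h0 : 0 ≤ τ)
    (h : τ < medianScore μ) : 1 / 2 ≤ (μ : Measure (Scored Ω)).real {z | τ ≤ (z.2 : ℝ)} := by
  have hne : {τ : ℝ | 1 / 2 ≤ (μ : Measure (Scored Ω)).real {z | τ ≤ (z.2 : ℝ)}}.Nonempty := by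
    by_contra hcon
    rw [Set.not_nonempty_iff_eq_empty] at hcon
    rw [medianScore, hcon, Real.sSup_empty] at h
    linarith
  obtain ⟨τ', hτ', hlt⟩ := exists_lt_of_lt_csSup hne h
  exact le_trans hτ' (measureReal_mono fun z (hz : τ' ≤ (z.2 : ℝ)) => hlt.le.trans hz)

/-- The largest grid point strictly below the best median loses at most 1/R. Some candidate reaches
it with probability at least 1/2, and this candidate is called with probability 1/K. -/
theorem exists_level_reachProb (hK : 0 < K) (hR : 0 < R) {γ : ℝ} (h0 : 0 ≤ γ) (h1 : γ ≤ 1)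
    (M : Fin K → ProbabilityMeasure (Scored Ω)) :
    ∃ r : Fin (R + 2), 1 / (2 * K) ≤ reachProb R γ M r ∧
      bestMedian M - 1 / R ≤ (r : ℝ) / R := by
  have hKpos : (0 : ℝ) < K := by positivity
  have hK1 : (1 : ℝ) ≤ K := by exact_mod_cast hK
  have hRpos : (0 : ℝ) < R := by positivity
  have hne : Nonempty (Fin K) := ⟨⟨0, hK⟩⟩
  have hτ1 : bestMedian M ≤ 1 := ciSup_le fun i => medianScore_le_one (M i)
  have hceil : ⌈R * bestMedian M⌉₊ ≤ R := by
    refine Nat.ceil_le.2 ?_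
    nlinarith
  have hlow : bestMedian M - 1 / R ≤ ((⌈R * bestMedian M⌉₊ - 1 : ℕ) : ℝ) / R := by
    have h1 := Nat.le_ceil (R * bestMedian M)
    have h2 : (⌈R * bestMedian M⌉₊ : ℝ) ≤ ((⌈R * bestMedian M⌉₊ - 1 : ℕ) : ℝ) + 1 := by
      have : ⌈R * bestMedian M⌉₊ ≤ ⌈R * bestMedian M⌉₊ - 1 + 1 := by omega
      exact_mod_cast this
    rw [le_div_iff₀ hRpos, sub_mul, div_mul_cancel₀ _ hRpos.ne']
    linarith
  -- Truncated subtraction gives level 0 when no positive grid point lies strictly below the best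
  -- median; that level is always reached.
  refine ⟨⟨⌈R * bestMedian M⌉₊ - 1, by omega⟩, ?_, hlow⟩
  rcases Nat.eq_zero_or_pos (⌈R * bestMedian M⌉₊ - 1) with hz | hz
  · have : (⟨⌈R * bestMedian M⌉₊ - 1, by omega⟩ : Fin (R + 2)) = 0 := Fin.ext hz
    rw [this, reachProb_zero hK h0 h1 M, div_le_one (by positivity)]
    linarith
  · have hlt : ((⌈R * bestMedian M⌉₊ - 1 : ℕ) : ℝ) < R * bestMedian M :=
      Nat.lt_ceil.1 (by omega)
    have hlt' : ((⌈R * bestMedian M⌉₊ - 1 : ℕ) : ℝ) / R < bestMedian M := by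
      rw [div_lt_iff₀ hRpos]
      linarith
    obtain ⟨i, hi⟩ := exists_lt_of_lt_ciSup hlt'
    have hhalf := half_le_of_lt_medianScore (by positivity) hi
    rw [reachProb_eq h0 h1 M]
    calc 1 / (2 * (K : ℝ)) = (1 / 2) / K := by field_simp
      _ ≤ (M i : Measure (Scored Ω)).real
          {x | ((⌈R * bestMedian M⌉₊ - 1 : ℕ) : ℝ) / R ≤ (x.2 : ℝ)} / K := by gcongr
      _ ≤ _ := Finset.single_le_sum (f := fun k => (M k : Measure (Scored Ω)).real
          {x | ((⌈R * bestMedian M⌉₊ - 1 : ℕ) : ℝ) / R ≤ (x.2 : ℝ)} / K)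
          (fun k _ => div_nonneg measureReal_nonneg hKpos.le) (Finset.mem_univ i)

end Guarantees

/-! ### Parameters -/

/-- The size of the term that dominates the number of calls. -/
theorem inv_rpow_bound {n a β : ℝ} (hn : 2 ≤ n) (ha : 0 ≤ a) (hβ : 0 < β) (hβ1 : β ≤ 1) :
    (2 * n / β) ^ (4 * a + 1) * (1 / β ^ 2) ≤ (n / β ^ 2) ^ (6 + 12 * a) ∧
      1 / β ≤ (n / β ^ 2) ^ (6 + 12 * a) := by
  set X := n / β ^ 2 with hX
  have hβ2 : β ^ 2 ≤ 1 := pow_le_one₀ hβ.le hβ1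
  have hβ2' : 0 < β ^ 2 := by positivity
  have hX1 : 1 ≤ X := by
    rw [hX, le_div_iff₀ hβ2']
    linarith
  have hX0 : 0 < X := by linarith
  have h1 : 2 * n / β ≤ X ^ (2 : ℝ) := by
    rw [Real.rpow_two, hX, div_pow, div_le_div_iff₀ hβ (by positivity)]
    have h3 : (β ^ 2) ^ 2 ≤ β := by
      calc (β ^ 2) ^ 2 = β * (β ^ 2 * β) := by ring
        _ ≤ β * 1 := by
            gcongr
            exact mul_le_one₀ hβ2 hβ.le hβ1
        _ = β := mul_one β
    calc 2 * n * (β ^ 2) ^ 2 ≤ n * n * β := by gcongr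
      _ = n ^ 2 * β := by ring
  have h2 : 1 / β ^ 2 ≤ X ^ (2 : ℝ) := by
    calc 1 / β ^ 2 ≤ X := by rw [hX]; gcongr; linarith
      _ = X ^ (1 : ℝ) := (Real.rpow_one X).symm
      _ ≤ _ := Real.rpow_le_rpow_of_exponent_le hX1 (by norm_num)
  have h3 : 1 / β ≤ 1 / β ^ 2 := by
    refine one_div_le_one_div_of_le hβ2' ?_
    nlinarith
  refine ⟨?_, h3.trans (h2.trans (Real.rpow_le_rpow_of_exponent_le hX1 (by linarith)))⟩
  calc (2 * n / β) ^ (4 * a + 1) * (1 / β ^ 2)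
      ≤ (X ^ (2 : ℝ)) ^ (4 * a + 1) * X ^ (2 : ℝ) := by
        refine mul_le_mul (Real.rpow_le_rpow (by positivity) h1 (by linarith)) h2 (by positivity)
          (by positivity)
    -- The exponent is 8a + 4, below the allowed 12a + 6.
    _ = X ^ (2 * (4 * a + 1) + 2) := by
        rw [← Real.rpow_mul hX0.le, ← Real.rpow_add hX0]
    _ ≤ _ := Real.rpow_le_rpow_of_exponent_le hX1 (by linarith)

/-- Here β + δ < 1 matters: it gives ln(R/δ) ≥ 1 - δ ≥ β, so that additive constants in the
logarithms are absorbed into L / β, where L = ln(R/δ). -/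
theorem log_bounds {R : ℕ} {β δ : ℝ} (hR : 0 < R) (hβ : 0 < β) (hδ : 0 < δ) (hβδ : β + δ < 1) :
    β ≤ Real.log (R / δ) ∧
      0 < Real.log (16 * R * (R + 2) / δ) ∧
      Real.log (16 * R * (R + 2) / δ) ≤ 49 * (Real.log (R / δ) / β) ∧
      0 ≤ Real.log (2 / δ) ∧ Real.log (2 / δ) ≤ 2 * (Real.log (R / δ) / β) := by
  have hRpos : (0 : ℝ) < R := by positivity
  have hR1 : (1 : ℝ) ≤ R := by exact_mod_cast hR
  have hβ1 : β ≤ 1 := by linarith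
  have hδ1 : δ ≤ 1 := by linarith
  set L := Real.log (R / δ) with hL
  have hLβ : β ≤ L := by
    have h1 : Real.log δ ≤ δ - 1 := Real.log_le_sub_one_of_pos hδ
    have h2 : 0 ≤ Real.log R := Real.log_nonneg hR1
    rw [hL, Real.log_div hRpos.ne' hδ.ne']
    linarith
  have hL0 : 0 < L := hβ.trans_le hLβ
  set l₁ := Real.log (16 * R * (R + 2) / δ) with hl₁
  have hl₁0 : 0 < l₁ := by
    refine Real.log_pos ?_
    rw [lt_div_iff₀ hδ]
    nlinarith
  have hl₁L : l₁ ≤ 49 * (L / β) := by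
    have h1 : 16 * R * (R + 2) / δ ≤ 48 * ((R : ℝ) / δ) ^ 2 := by
      rw [div_pow, ← mul_div_assoc, div_le_div_iff₀ hδ (by positivity)]
      calc 16 * (R : ℝ) * (R + 2) * δ ^ 2 ≤ 16 * R * (R + 2 * R) * (δ * 1) := by
            rw [pow_two]
            gcongr
            linarith
        _ = _ := by ring
    have h2 : l₁ ≤ Real.log 48 + 2 * L := by
      calc l₁ ≤ Real.log (48 * ((R : ℝ) / δ) ^ 2) := Real.log_le_log (by positivity) h1
        _ = _ := by
            rw [Real.log_mul (by norm_num) (by positivity), Real.log_pow]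
            norm_num [hL]
    have h3 : Real.log 48 ≤ 47 := by
      have := Real.log_le_sub_one_of_pos (x := 48) (by norm_num)
      linarith
    have h4 : 1 ≤ L / β := by rwa [one_le_div hβ]
    have h5 : L ≤ L / β := le_div_self hL0.le hβ hβ1
    linarith
  set l₂ := Real.log (2 / δ) with hl₂
  have hl₂L : l₂ ≤ 2 * (L / β) := by
    have h1 : l₂ ≤ Real.log 2 + L := by
      rw [hl₂, hL, ← Real.log_mul (by norm_num) (by positivity)]
      refine Real.log_le_log (by positivity) ?_
      rw [← mul_div_assoc]
      gcongr
      linarith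
    have h3 : Real.log 2 ≤ 1 := by
      have := Real.log_le_sub_one_of_pos (x := 2) (by norm_num)
      linarith
    have h4 : 1 ≤ L / β := by rwa [one_le_div hβ]
    have h5 : L ≤ L / β := le_div_self hL0.le hβ hβ1
    linarith
  have hl₂0 : 0 ≤ l₂ := by
    refine Real.log_nonneg ?_
    rw [le_div_iff₀ hδ]
    linarith
  exact ⟨hLβ, hl₁0, hl₁L, hl₂0, hl₂L⟩

/-- The spare factor 1/β² in `hminv` pays both for the 1/β in the bounds on the logarithms and for
the 1/β in 1/γ. -/
theorem calls_bound {k m ε₀ β γ Q L l₁ l₂ n₁ n₂ : ℝ} (hm : 0 < m) (hε₀ : 0 < ε₀) (hε₀1 : ε₀ ≤ 1)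
    (hβ : 0 < β) (hβ1 : β ≤ 1) (hγ : γ = β * m / 4) (hk : 1 ≤ k) (hLβ : β ≤ L)
    (hQ : 1 / β ≤ Q) (hminv : 1 / m * (1 / β ^ 2) ≤ 4 * k * Q) (hl₁ : l₁ ≤ 49 * (L / β))
    (hl₂ : l₂ ≤ 2 * (L / β)) (h1 : n₁ ≤ 1024 / (m * ε₀ ^ 2) * l₁ + 1) (h2 : n₂ ≤ l₂ / γ + 1) :
    n₁ + n₂ ≤ 300000 * (k * Q * (L / ε₀ ^ 2)) := by
  have hL0 : 0 < L := hβ.trans_le hLβ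
  have hγ0 : 0 < γ := by rw [hγ]; positivity
  have hQ0 : 0 < Q := lt_of_lt_of_le (by positivity) hQ
  set T := L / ε₀ ^ 2 with hT
  have hε2 : ε₀ ^ 2 ≤ 1 := pow_le_one₀ hε₀.le hε₀1
  have hLT : L ≤ T := le_div_self hL0.le (by positivity) hε2
  have hT0 : 0 < T := hL0.trans_le hLT
  have hβ2 : 1 / β ≤ 1 / β ^ 2 := by
    refine one_div_le_one_div_of_le (by positivity) ?_
    nlinarith
  have h3 : 1024 / (m * ε₀ ^ 2) * l₁ ≤ 200704 * (k * Q * T) := by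
    calc 1024 / (m * ε₀ ^ 2) * l₁ ≤ 1024 / (m * ε₀ ^ 2) * (49 * (L / β)) := by gcongr
      _ = 50176 * (1 / m * (1 / β)) * T := by
          rw [hT]
          field_simp
          ring
      _ ≤ 50176 * (1 / m * (1 / β ^ 2)) * T := by gcongr
      _ ≤ 50176 * (4 * k * Q) * T := by gcongr
      _ = _ := by ring
  have h4 : l₂ / γ ≤ 32 * (k * Q * T) := by
    calc l₂ / γ ≤ 2 * (L / β) / γ := by gcongr
      _ = 8 * (1 / m * (1 / β ^ 2)) * L := by
          rw [hγ]
          field_simp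
          ring
      _ ≤ 8 * (4 * k * Q) * T := by gcongr
      _ = _ := by ring
  -- This absorbs the two roundings: Q ≥ 1/β and T ≥ L ≥ β.
  have h5 : 1 ≤ k * Q * T := by
    calc (1 : ℝ) = 1 * (1 / β) * β := by field_simp
      _ ≤ k * Q * T := by
          gcongr
          exact hLβ.trans hLT
  refine (add_le_add (h1.trans (add_le_add_left h3 1)) (h2.trans (add_le_add_left h4 1))).trans ?_
  generalize k * Q * T = U at h5 ⊢
  linarith

theorem exists_selection_parameters {K R : ℕ} {ε₁ ε₀ β δ : ℝ} (hK : 0 < K) (hR : 0 < R)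
    (hε₁ : 0 < ε₁) (hε₀ : 0 < ε₀) (hε₀1 : ε₀ ≤ 1) (hβ : 0 < β) (hδ : 0 < δ) (hβδ : β + δ < 1) :
    ∃ (N₁ N₂ : ℕ) (γ m s x : ℝ), 0 < N₁ ∧ 0 < γ ∧ γ ≤ 1 ∧ 0 < m ∧ 0 ≤ s ∧ 0 < x ∧ x ≤ 1 ∧
      m = 1 / (4 * K) * x ^ 2 ∧ x ^ s = (β / 2) / (R + 1) ∧
      2 * s * (ε₁ + 4 * (ε₀ / 16)) = ε₀ ∧ γ = β * m / 4 ∧ (1 - γ) ^ N₂ ≤ δ / 2 ∧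
      (R + 2) * (2 * Real.exp (-(N₁ * m * (ε₀ / 16) ^ 2 / 4))) ≤ δ / (8 * R) ∧
      ((N₁ + N₂ : ℕ) : ℝ) ≤ 300000 * (K * ((R + 1) / β ^ 2) ^ (6 + 12 * ε₁ / ε₀) *
        (Real.log (R / δ) / ε₀ ^ 2)) := by
  have hKpos : (0 : ℝ) < K := by positivity
  have hK1 : (1 : ℝ) ≤ K := by exact_mod_cast hK
  have hRpos : (0 : ℝ) < R := by positivity
  have hR1 : (1 : ℝ) ≤ R := by exact_mod_cast hR
  have hβ1 : β ≤ 1 := by linarith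
  have hδ1 : δ ≤ 1 := by linarith
  set a := ε₁ / ε₀ with ha
  have ha0 : 0 ≤ a := by positivity
  obtain ⟨hLβ, hl₁0, hl₁L, hl₂0, hl₂L⟩ := log_bounds hR hβ hδ hβδ
  set L := Real.log (R / δ) with hL
  have hL0 : 0 < L := hβ.trans_le hLβ
  set l₁ := Real.log (16 * R * (R + 2) / δ) with hl₁
  set l₂ := Real.log (2 / δ) with hl₂
  set x : ℝ := ((β / 2) / (R + 1)) ^ (2 * a + 1 / 2) with hx
  have hbase : 0 < (β / 2) / ((R : ℝ) + 1) := by positivity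
  have hbase1 : (β / 2) / ((R : ℝ) + 1) ≤ 1 := by
    rw [div_le_one (by positivity)]
    linarith
  have hx0 : 0 < x := Real.rpow_pos_of_pos hbase _
  have hx1 : x ≤ 1 := Real.rpow_le_one hbase.le hbase1 (by positivity)
  set m : ℝ := 1 / (4 * K) * x ^ 2 with hm
  have hm0 : 0 < m := by positivity
  have hm1 : m ≤ 1 := by
    have h1 : 1 / (4 * (K : ℝ)) ≤ 1 := by
      rw [div_le_one (by positivity)]
      linarith
    exact mul_le_one₀ h1 (by positivity) (pow_le_one₀ hx0.le hx1)
  set γ : ℝ := β * m / 4 with hγ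
  have hγ0 : 0 < γ := by positivity
  have hγ1 : γ ≤ 1 := by
    have : β * m ≤ 1 := mul_le_one₀ hβ1 hm0.le hm1
    linarith
  set Q : ℝ := ((R + 1) / β ^ 2) ^ (6 + 12 * ε₁ / ε₀) with hQ
  have hexp : 6 + 12 * ε₁ / ε₀ = 6 + 12 * a := by rw [ha]; ring
  obtain ⟨hQ1, hQ2⟩ := inv_rpow_bound (n := (R : ℝ) + 1) (by linarith) ha0 hβ hβ1
  rw [← hexp, ← hQ] at hQ1 hQ2
  have hQ0 : 0 < Q := lt_of_lt_of_le (by positivity) hQ2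
  have hminv : 1 / m * (1 / β ^ 2) ≤ 4 * K * Q := by
    have h1 : 1 / m = 4 * K * (2 * (R + 1) / β) ^ (4 * a + 1) := by
      have h2 : (2 * ((R : ℝ) + 1) / β) = ((β / 2) / (R + 1))⁻¹ := by
        field_simp
      have h3 : x ^ 2 = ((β / 2) / ((R : ℝ) + 1)) ^ (4 * a + 1) := by
        rw [hx, ← Real.rpow_two, ← Real.rpow_mul hbase.le]
        congr 1
        ring
      rw [h2, Real.inv_rpow hbase.le, ← h3, hm]
      field_simp
    rw [h1, mul_assoc]
    exact mul_le_mul_of_nonneg_left hQ1 (by positivity)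
  -- With η = ε₀/16 the privacy equation reads 2s(ε₁ + ε₀/4) = ε₀, so 1/s = 2a + 1/2, which is also
  -- the exponent in `x`. The 1024 is 4 · 16² from the Chernoff exponent, and `l₁` is chosen so that
  -- the union bound gives exactly δ/(8R).
  refine ⟨⌈1024 / (m * ε₀ ^ 2) * l₁⌉₊, ⌈l₂ / γ⌉₊, γ, m, (2 * a + 1 / 2)⁻¹, x, ?_, hγ0, hγ1, hm0,
    by positivity, hx0, hx1, rfl, ?_, ?_, rfl, ?_, ?_, ?_⟩
  · exact Nat.ceil_pos.2 (by positivity)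
  · exact Real.rpow_rpow_inv hbase.le (by positivity)
  · rw [ha]
    field_simp
    ring
  · have h1 := Nat.le_ceil (l₂ / γ)
    rw [div_le_iff₀ hγ0] at h1
    calc (1 - γ) ^ ⌈l₂ / γ⌉₊ ≤ Real.exp (-γ) ^ ⌈l₂ / γ⌉₊ :=
          pow_le_pow_left₀ (by linarith) (by linarith [Real.add_one_le_exp (-γ)]) _
      _ = Real.exp (⌈l₂ / γ⌉₊ * -γ) := (Real.exp_nat_mul _ _).symm
      _ ≤ Real.exp (-l₂) := Real.exp_le_exp.2 (by linarith)
      _ = δ / 2 := by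
          rw [hl₂, Real.exp_neg, Real.exp_log (by positivity), inv_div]
  · have h1 := Nat.le_ceil (1024 / (m * ε₀ ^ 2) * l₁)
    set N := (⌈1024 / (m * ε₀ ^ 2) * l₁⌉₊ : ℝ)
    have h2 : l₁ ≤ N * m * (ε₀ / 16) ^ 2 / 4 := by
      calc l₁ = 1024 / (m * ε₀ ^ 2) * l₁ * m * (ε₀ / 16) ^ 2 / 4 := by
            field_simp
            ring
        _ ≤ _ := by gcongr
    calc ((R : ℝ) + 2) * (2 * Real.exp (-(N * m * (ε₀ / 16) ^ 2 / 4)))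
        ≤ (R + 2) * (2 * Real.exp (-l₁)) := by gcongr
      _ = δ / (8 * R) := by
          rw [hl₁, Real.exp_neg, Real.exp_log (by positivity), inv_div]
          field_simp
          ring
  · have h1 := (Nat.ceil_lt_add_one (a := 1024 / (m * ε₀ ^ 2) * l₁) (by positivity)).le
    have h2 := (Nat.ceil_lt_add_one (a := l₂ / γ) (by positivity)).le
    rw [Nat.cast_add]
    exact calls_bound hm0 hε₀ hε₀1 hβ hβ1 rfl hK1 hLβ hQ2 hminv hl₁L hl₂L h1 h2

/-! ### The trivial algorithm -/

theorem exists_algorithm_no_calls {K : ℕ} (hK : 0 < K) (X : Type v) [MeasurableSpace X] :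
    ∃ A : OracleAlgorithm K X, (∀ ω, A.calls ω = 0) ∧ ∀ ω, A.outcome ω = Sum.inl () := by
  refine ⟨OracleAlgorithm.ofFixedCalls hK 0 Unit ⟨Measure.dirac (), inferInstance⟩
    (fun j _ => j.elim0) (fun j => j.elim0) (fun _ => none) fun a => MeasurableSet.const _,
    fun ω => ?_, fun ω => ?_⟩
  · exact OracleAlgorithm.ofFixedCalls_calls _ _ _ _ _ _ _ _ ω
  · exact OracleAlgorithm.ofFixedCalls_outcome _ _ _ _ _ _ _ _ ω

end PrivateSelection

/-! ### The main theorem -/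

open PrivateSelection in
theorem mainTheorem1 :
    ∃ C : ℝ, 0 < C ∧
      ∀ (K R : ℕ) (ε₁ ε₀ β δ : ℝ), 0 < K → 0 < R → 0 < ε₁ → 0 < ε₀ → ε₀ ≤ 1 → 0 < β →
        0 < δ → δ < 1 →
      ∀ (Ω : Type v) [MeasurableSpace Ω],
      ∃ A : PrivateSelection.OracleAlgorithm K (PrivateSelection.Scored Ω),
      ∀ (𝒟 : Type u) (adj : 𝒟 → 𝒟 → Prop), (∀ D D', adj D D' → adj D' D) →
      ∀ M : Fin K → 𝒟 → MeasureTheory.ProbabilityMeasure (PrivateSelection.Scored Ω),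
        (∀ i, PrivateSelection.IsDP adj ε₁ 0 (M i)) →
        PrivateSelection.IsDP adj (2 * ε₁ + ε₀) δ (fun D => A.outputLaw fun i => M i D) ∧
        ∀ D : 𝒟,
          (A.outputLaw fun i => M i D : MeasureTheory.Measure
              (PrivateSelection.Outcome K (PrivateSelection.Scored Ω))).real
              {o | ∃ (i : Fin K) (z : PrivateSelection.Scored Ω), o = Sum.inr (i, z) ∧
                (z.2 : ℝ) < PrivateSelection.bestMedian (fun i => M i D) - 1 / R}
            ≤ β + δ / R ∧
          (A.outputLaw fun i => M i D : MeasureTheory.Measure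
              (PrivateSelection.Outcome K (PrivateSelection.Scored Ω))).real {Sum.inl ()} ≤ β + δ ∧
          A.expectedCalls (fun i => M i D) ≤ ENNReal.ofReal
            (C * (K * ((R + 1) / β ^ 2) ^ (6 + 12 * ε₁ / ε₀) *
              (Real.log (R / δ) / ε₀ ^ 2 + 1 / β))) ∧
          ∀ ω : A.Randomness, (A.calls ω : ENNReal) ≤ ENNReal.ofReal
            (C * (K * ((R + 1) / β ^ 2) ^ (6 + 12 * ε₁ / ε₀) *
              (Real.log (R / δ) / ε₀ ^ 2 + Real.log (1 / ε₀) / β))) := by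
  refine ⟨300000, by norm_num, ?_⟩
  intro K R ε₁ ε₀ β δ hK hR hε₁ hε₀ hε₀1 hβ hδ hδ1 Ω _
  have hKpos : (0 : ℝ) < K := by positivity
  have hRpos : (0 : ℝ) < R := by positivity
  have hR1 : (1 : ℝ) ≤ R := by exact_mod_cast hR
  have hlog : 0 ≤ Real.log (1 / ε₀) / β := div_nonneg
    (Real.log_nonneg (by rw [le_div_iff₀ hε₀]; linarith)) hβ.le
  -- In the first case ⊥ is allowed with certainty, and never releasing a sample satisfies every
  -- other claim.
  by_cases hβδ : 1 ≤ β + δ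
  · obtain ⟨A, hcalls, hout⟩ := exists_algorithm_no_calls hK (Scored Ω)
    have hlaw : ∀ (M : Fin K → ProbabilityMeasure (Scored Ω)) (S : Set (Outcome K (Scored Ω))),
        MeasurableSet S → (A.outputLaw M : Measure (Outcome K (Scored Ω))).real S =
          (A.runLaw M : Measure A.Randomness).real {_ω | Sum.inl () ∈ S} := by
      intro M S hS
      refine (map_measureReal_apply A.measurable_outcome hS).trans ?_
      congr 1
      ext ω
      simp [hout]
    refine ⟨A, fun 𝒟 adj _ M _ => ⟨fun D D' _ S hS => ?_, fun D => ⟨?_, ?_, ?_, fun ω => ?_⟩⟩⟩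
    · dsimp only
      rw [hlaw _ S hS, hlaw _ S hS]
      by_cases h : (Sum.inl () : Outcome K (Scored Ω)) ∈ S
      · have : 1 ≤ Real.exp (2 * ε₁ + ε₀) := Real.one_le_exp (by positivity)
        simp only [h, Set.ofPred_true, probReal_univ]
        linarith
      · simp [h, hδ.le]
    · rw [hlaw _ _ (measurableSet_low K _)]
      simp only [Set.mem_ofPred_eq, reduceCtorEq, false_and, exists_false, Set.ofPred_false,
        measureReal_empty]
      positivity
    · exact measureReal_le_one.trans hβδ
    · simp [OracleAlgorithm.expectedCalls, hcalls]
    · simp [hcalls]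
  · push Not at hβδ
    obtain ⟨N₁, N₂, γ, m, s, x, hN₁, hγ0, hγ1, hm0, hs, hx0, hx1, hm, hxs, hsη, hγ, hδ₂, hdev, hN⟩ :=
      exists_selection_parameters hK hR hε₁ hε₀ hε₀1 hβ hδ hβδ
    have hb0 : (0 : ℝ) < 1 / (4 * K) := by positivity
    have hK1 : (1 : ℝ) ≤ K := by exact_mod_cast hK
    have hb1 : 1 / (4 * (K : ℝ)) ≤ 1 / 2 :=
      one_div_le_one_div_of_le (by norm_num) (by linarith)
    have hδR : δ / (8 * R) ≤ δ / 8 := by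
      gcongr
      linarith
    have hδR' : δ / (8 * R) ≤ δ / R := by
      gcongr
      linarith
    have hd : ∀ M : Fin K → ProbabilityMeasure (Scored Ω),
        ∑ k ∈ deviating N₁ m (ε₀ / 16) (reachProb R γ M), countProb γ M k ≤ δ / (8 * R) :=
      fun M => (sum_countProb_deviating_le hK hN₁ hγ0.le hγ1 (by positivity) (by linarith) M).trans
        hdev
    -- The main term alone suffices; `c` stands for either of the two nonnegative terms 1/β and
    -- ln(1/ε₀)/β.
    have hcallsle : ∀ c : ℝ, 0 ≤ c → (((N₁ + N₂ : ℕ) : ℕ∞) : ℝ≥0∞) ≤ ENNReal.ofReal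
        (300000 * (K * ((R + 1) / β ^ 2) ^ (6 + 12 * ε₁ / ε₀) *
          (Real.log (R / δ) / ε₀ ^ 2 + c))) := by
      intro c hc
      rw [ENat.toENNReal_coe, ← ENNReal.ofReal_natCast]
      refine ENNReal.ofReal_le_ofReal (hN.trans ?_)
      gcongr
      linarith
    set A := selectionAlgorithm (R := R) (N₁ := N₁) (Ω := Ω) hK N₂
      (q := fun h => levelProb m (1 / (4 * K)) s (empiricalProb h))
      (fun h r => levelProb_nonneg hm0 hb0 r) (fun h => sum_levelProb hm0 hb0) hγ0.le hγ1
    have hlaw : ∀ (M : Fin K → ProbabilityMeasure (Scored Ω)) (S : Set (Outcome K (Scored Ω))),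
        MeasurableSet S → (A.outputLaw M : Measure (Outcome K (Scored Ω))).real S = _ :=
      fun M S hS => selectionAlgorithm_outputLaw hK N₂ _ _ hγ0.le hγ1 M hS
    refine ⟨A, fun 𝒟 adj hsymm M hM => ⟨fun D D' hDD' S hS => ?_, fun D => ⟨?_, ?_, ?_, fun ω => ?_⟩⟩⟩
    · dsimp only
      rw [hlaw _ S hS, hlaw _ S hS]
      refine (selection_privacy hK hγ0 hγ1 hε₁.le hε₀1 hm0 hb0 hs (by positivity) (by linarith) hsη
        (M := fun i => M i D) (M' := fun i => M i D')
        (fun i S hS => by simpa using hM i D D' hDD' S hS)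
        (fun i S hS => by simpa using hM i D' D (hsymm D D' hDD') S hS) (hd _) (hd _) hδ₂
        hS).trans ?_
      gcongr
      linarith
    · rw [hlaw _ _ (measurableSet_low K _)]
      obtain ⟨r₀, hr₀, hr₀'⟩ := exists_level_reachProb hK hR hγ0.le hγ1 fun i => M i D
      refine (selection_utility hK hR (t := 0) hγ0.le hγ1 hb0 hb1 hs (by linarith) hx0 hx1 hm
        (by positivity) hxs _ (hd _) le_rfl
        (fun r => releaseProb_le_one hK hγ0.le hγ1 _ r _) fun r _ hr => ?_).trans ?_
      · refine (releaseProb_low hK hγ0.le hγ1 _ r ?_).le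
        refine hr₀'.trans ?_
        -- The curve is at least 1/(2K) = 2b at `r₀` and below 2b at `r + 1`, so monotonicity puts
        -- `r₀` at or below `r`.
        have hlt : r₀ < r.succ := by
          by_contra! hcon
          have h1 := reachProb_antitone hK hγ0.le hγ1 (fun i => M i D) hcon
          have h2 : 2 * (1 / (4 * (K : ℝ))) = 1 / (2 * K) := by field_simp; norm_num
          linarith
        have hle : (r₀ : ℕ) ≤ r := Nat.lt_succ_iff.1 hlt
        gcongr
      · linarith
    · have hbot : MeasurableSet {(Sum.inl () : Outcome K (Scored Ω))} := measurableSet_bot_outcome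
      rw [hlaw _ _ hbot]
      refine (selection_utility hK hR (t := β / 2 + δ / 2) hγ0.le hγ1 hb0 hb1 hs (by linarith) hx0
        hx1 hm (by positivity) hxs _ (hd _) (by positivity)
        (fun r => releaseProb_le_one hK hγ0.le hγ1 _ r _) fun r hr _ => ?_).trans ?_
      · have hpos : 0 < reachProb R γ (fun i => M i D) r.castSucc := by linarith
        refine (releaseProb_bot_le hK hγ0 hγ1 _ r hpos).trans (add_le_add ?_ hδ₂)
        rw [div_le_iff₀ hpos]
        -- The value γ = βm/4 is chosen so that heads comes first with probability at most β/2 at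
        -- levels reached with probability more than m/2.
        calc γ = β / 2 * (m / 2) := by rw [hγ]; ring
          _ ≤ _ := by gcongr
      · linarith
    · refine le_of_eq_of_le (OracleAlgorithm.ofFixedCalls_expectedCalls _ _ _ _ _ _ _ _ _) ?_
      simpa using hcallsle (1 / β) (by positivity)
    · refine le_of_eq_of_le (congrArg _ (OracleAlgorithm.ofFixedCalls_calls _ _ _ _ _ _ _ _ ω)) ?_
      exact hcallsle _ hlog
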